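/- **Proposition 4.1 (Existence and uniqueness).** Let $d\ge 2$, let $\Omega\subset\mathbb R^d$ be a polyhedral domain and let $(\Gamma_i)_{i\in I}$ be a finite family of pairwise disjoint, polygonal, simply connected, relatively open subsets of hyperplanes, contained in $\Omega$, each with a chosen unit normal $\mathbf n^+$ (outward from its positive side). Set $\Gamma=\bigcup_i\Gamma_i$ and assume that $\Omega\setminus\overline\Gamma$ is connected. Let $\mathcal M$ (cells), $\mathcal F$ (planar faces), $\mathcal V$ (nodes) be a finite polytopal mesh of $\Omega$ conforming with $\Gamma$: with $\mathcal F_\Gamma$ the set of faces contained in some $\Gamma_i$, $\overline\Gamma=\bigcup_{\sigma\in\mathcal F_\Gamma}\overline\sigma$. Let $\mathcal F_K,\mathcal V_K$ be the faces and nodes of the cell $K$, $\mathcal V_\sigma$ the nodes of $\sigma$, $\mathbf n_{K\sigma}$ the unit normal to $\sigma$ outward to $K$, $h_K$ the diameter of $K$, $\overline{\mathbf x}_K$ and $\overline{\mathbf x}_\sigma$ the centers of mass, and $\mathcal F^+_{\Gamma,K}=\{\sigma\in\mathcal F_\Gamma\cap\mathcal F_K:\mathbf n_{K\sigma}\cdot\mathbf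 n^+>0\}$. Fix nonnegative weights with $\sum_{s\in\mathcal V_\sigma}\omega^\sigma_s=1$, $\sum_{s\in\mathcal V_\sigma}\omega^\sigma_s\mathbf x_s=\overline{\mathbf x}_\sigma$ for each face and $\sum_{s\in\mathcal V_K}\omega^K_s=1$, $\sum_{s\in\mathcal V_K}\omega^K_s\mathbf x_s=\overline{\mathbf x}_K$ for each cell. Let the Lamé coefficients $\mu,\lambda$ be integrable on $\Omega$ with $\mu>0$ and $2\mu+d\lambda>0$ a.e., let $\mathbf f\in L^2(\Omega)^d$, and let $\mathrm g\ge0$ be constant on each $\sigma\in\mathcal F_\Gamma$. *Spaces.* $\mathbf U_{0,\mathcal D}$ is the space of families $\mathbf v=((\mathbf v_{\mathcal Ks})_{K\in\mathcal M,s\in\mathcal V_K},(\mathbf v_{K\sigma})_{K\in\mathcal M,\sigma\in\mathcal F^+_{\Gamma,K}})$ of vectors of $\mathbb R^d$ with $\mathbf v_{\mathcal Ks}=0$ if $s\in\partial\Omega$ and $\mathbf v_{\mathcal Ks}=\mathbf v_{\mathcal Ls}$ if the cells $K,L$ containing $s$ lie on the same side of $\Gamma$ at $s$, i.e. meet a common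 connected component of $\Omega\setminus\overline\Gamma$ in every ball around $s$. $\mathbf M_{\mathcal D}$ is the space of vector fields on $\Gamma$ with a constant value $\boldsymbol\lambda_\sigma\in\mathbb R^d$ on each $\sigma\in\mathcal F_\Gamma$, and $$\mathbf C_{\mathcal D}=\{\boldsymbol\lambda\in\mathbf M_{\mathcal D}:\ \boldsymbol\lambda\cdot\mathbf n^+\ge0,\ |\boldsymbol\lambda-(\boldsymbol\lambda\cdot\mathbf n^+)\mathbf n^+|\le \mathrm g\}.$$ *Operators.* Let $\overline{\mathbf v}_{K\sigma}=\sum_{s\in\mathcal V_\sigma}\omega^\sigma_s\mathbf v_{\mathcal Ks}$, $\overline{\mathbf v}_K=\sum_{s\in\mathcal V_K}\omega^K_s\mathbf v_{\mathcal Ks}$, and, for $\sigma\in\mathcal F_\Gamma$ with $K$, $L$ the cells on its positive and negative sides, $[\![\mathbf v]\!]_{\mathcal D}|_\sigma=\overline{\mathbf v}_{K\sigma}-\overline{\mathbf v}_{L\sigma}+\mathbf v_{K\sigma}$. On each cell $K$, let $$\nabla^K\mathbf v=\frac1{|K|}\sum_{\sigma\in\mathcal F_K}|\sigma|\,\overline{\mathbf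 v}_{K\sigma}\otimes\mathbf n_{K\sigma}+\sum_{\sigma\in\mathcal F^+_{\Gamma,K}}\frac{|\sigma|}{|K|}\mathbf v_{K\sigma}\otimes\mathbf n_{K\sigma},\qquad \Pi^K\mathbf v(\mathbf x)=\nabla^K\mathbf v\,(\mathbf x-\overline{\mathbf x}_K)+\overline{\mathbf v}_K,$$ and let $\epsilon_{\mathcal D}(\mathbf v)|_K=\frac12(\nabla^K\mathbf v+(\nabla^K\mathbf v)^T)$, $\sigma_{\mathcal D}(\mathbf v)=2\mu\,\epsilon_{\mathcal D}(\mathbf v)+\lambda\,\mathrm{Tr}(\epsilon_{\mathcal D}(\mathbf v))\,\mathbb I$, $\widetilde\Pi^{\mathcal D}\mathbf v|_K=\overline{\mathbf v}_K$. With $\mu_K,\lambda_K$ the averages of $\mu,\lambda$ on $K$, let $S(\mathbf u,\mathbf v)=\sum_{K}(2\mu_K+\lambda_K)S_K(\mathbf u,\mathbf v)$, where $$S_K(\mathbf u,\mathbf v)=h_K^{d-2}\sum_{s\in\mathcal V_K}(\mathbf u_{\mathcal Ks}-\Pi^K\mathbf u(\mathbf x_s))\cdot(\mathbf v_{\mathcal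 Ks}-\Pi^K\mathbf v(\mathbf x_s))+h_K^{d-2}\sum_{\sigma\in\mathcal F^+_{\Gamma,K}}\mathbf u_{K\sigma}\cdot\mathbf v_{K\sigma}.$$ *Claim.* There is exactly one pair $(\mathbf u_{\mathcal D},\boldsymbol\lambda_{\mathcal D})\in\mathbf U_{0,\mathcal D}\times\mathbf C_{\mathcal D}$ such that, for all $\mathbf v\in\mathbf U_{0,\mathcal D}$ and all $\boldsymbol\mu\in\mathbf C_{\mathcal D}$, $$\int_\Omega\sigma_{\mathcal D}(\mathbf u_{\mathcal D}):\epsilon_{\mathcal D}(\mathbf v)+S(\mathbf u_{\mathcal D},\mathbf v)+\int_\Gamma\boldsymbol\lambda_{\mathcal D}\cdot[\![\mathbf v]\!]_{\mathcal D}=\int_\Omega\mathbf f\cdot\widetilde\Pi^{\mathcal D}\mathbf v,\qquad \int_\Gamma(\boldsymbol\mu-\boldsymbol\lambda_{\mathcal D})\cdot[\![\mathbf u_{\mathcal D}]\!]_{\mathcal D}\le0.$$ -/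

import Mathlib

open MeasureTheory Set
open scoped InnerProductSpace Matrix

/-- The Euclidean space `ℝᵈ`. -/
abbrev Space (d : ℕ) : Type := EuclideanSpace ℝ (Fin d)

/-! ### Polytopal sets, domain, fracture network -/

/-- `S` is an open polytopal subset of the `m`-dimensional affine subspace `H`: it is the interior,
relative to `H`, of a finite union of closed `m`-dimensional simplices of `H`. -/
def IsPolytopalIn {d : ℕ} (m : ℕ) (H S : Set (Space d)) : Prop :=
  ∃ T : Set (Set (Space d)), T.Finite ∧
    (∀ Δ ∈ T, ∃ p : Fin (m + 1) → Space d,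
      AffineIndependent ℝ p ∧ range p ⊆ H ∧ Δ = convexHull ℝ (range p)) ∧
    S = {x | x ∈ H ∧ ∃ r > 0, Metric.ball x r ∩ H ⊆ ⋃₀ T}

/-- `x` is a vertex (corner) of the polytopal set `S`: it is a point of the closure of `S` near
which `S` is not invariant under translations in any direction `w ≠ 0`. -/
def IsVertex {d : ℕ} (S : Set (Space d)) (x : Space d) : Prop :=
  x ∈ closure S ∧ ∀ w : Space d,
    (∃ r > 0, ∀ y ∈ Metric.ball x r, ∀ t : ℝ, y + t • w ∈ Metric.ball x r →
      (y ∈ S ↔ y + t • w ∈ S)) → w = 0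

/-- A polyhedral domain of `ℝᵈ` (it is open and bounded, see `IsPolytopalIn`). -/
structure PolyhedralDomain (d : ℕ) where
  carrier : Set (Space d)
  polytopal : IsPolytopalIn d univ carrier
  connected : IsConnected carrier

/-- A network of planar fractures `Γ i ⊆ Ω`, with unit normals `n⁺`. -/
structure FractureNetwork {d : ℕ} (Ω : PolyhedralDomain d) (I : Type*) where
  /-- the fractures `Γ i` -/
  frac : I → Set (Space d)
  /-- the unit normal `n⁺` to `Γ i`, oriented outward from the positive side -/
  normal : I → Space d
  /-- `Γ i` lies in the hyperplane `⟪normal i, x⟫ = offset i` -/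
  offset : I → ℝ
  norm_normal : ∀ i, ‖normal i‖ = 1
  polytopal : ∀ i, IsPolytopalIn (d - 1) {x | ⟪normal i, x⟫_ℝ = offset i} (frac i)
  simplyConnected : ∀ i, SimplyConnectedSpace (frac i)
  subset_domain : ∀ i, frac i ⊆ Ω.carrier
  disjoint : Pairwise fun i j => Disjoint (frac i) (frac j)

/-- The closed network `Γ̄`. -/
def FractureNetwork.closedNetwork {d : ℕ} {Ω : PolyhedralDomain d} {I : Type*}
    (N : FractureNetwork Ω I) : Set (Space d) :=
  closure (⋃ i, N.frac i)

/-! ### Polytopal meshes -/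

/-- `n` is the unit normal to the face `σ`, outward to the cell `K`: locally around each point of
`σ`, the cell `K` is the half-space on the side opposite to `n`. -/
def IsOutwardNormal {d : ℕ} (K σ : Set (Space d)) (n : Space d) : Prop :=
  ‖n‖ = 1 ∧ ∀ x ∈ σ, ∃ r > 0, ∀ y ∈ Metric.ball x r, (y ∈ K ↔ ⟪y - x, n⟫_ℝ < 0)

/-- A polytopal mesh of `Ω` with planar faces: `M` indexes the cells and `F` the faces. -/
structure PolytopalMesh {d : ℕ} (Ω : PolyhedralDomain d) (M F : Type*) where
  cell : M → Set (Space d)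
  face : F → Set (Space d)
  nodes : Finset (Space d)
  /-- the outward unit normals `n_{Kσ}` (meaningful when `σ` is a face of `K`) -/
  normal : M → F → Space d
  /-- the cells are disjoint (open, nonempty) polyhedra that cover `Ω` -/
  cell_polytopal : ∀ K, IsPolytopalIn d univ (cell K)
  cell_connected : ∀ K, IsConnected (cell K)
  cell_disjoint : Pairwise fun K L => Disjoint (cell K) (cell L)
  closure_domain : closure Ω.carrier = ⋃ K, closure (cell K)
  /-- each face is a connected, relatively open subset of a hyperplane, with a relative boundary of
  zero surface measure; the faces are disjoint and partition the boundaries of the cells -/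
  face_planar : ∀ σ, ∃ (ν : Space d) (c : ℝ), ‖ν‖ = 1 ∧ face σ ⊆ {x | ⟪ν, x⟫_ℝ = c} ∧
    ∀ x ∈ face σ, ∃ r > 0, Metric.ball x r ∩ {y | ⟪ν, y⟫_ℝ = c} ⊆ face σ
  face_connected : ∀ σ, IsConnected (face σ)
  face_boundary_null : ∀ σ, μHE[d - 1] (closure (face σ) \ face σ) = 0
  face_disjoint : Pairwise fun σ τ => Disjoint (face σ) (face τ)
  skeleton : ⋃ K, frontier (cell K) = ⋃ σ, closure (face σ)
  /-- each face is an interface between two cells or a boundary face -/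
  face_adjacent : ∀ σ,
    (∃ K L, K ≠ L ∧ face σ ⊆ frontier (cell K) ∧ face σ ⊆ frontier (cell L)) ∨
    (∃ K, face σ ⊆ frontier (cell K) ∧ face σ ⊆ frontier Ω.carrier)
  isOutwardNormal : ∀ K σ, face σ ⊆ frontier (cell K) →
    IsOutwardNormal (cell K) (face σ) (normal K σ)
  /-- the nodes comprise the vertices of all faces, and lie on the boundaries of faces -/
  vertex_mem_nodes : ∀ σ x, IsVertex (face σ) x → x ∈ nodes
  node_mem_boundary : ∀ s ∈ nodes, ∃ σ, s ∈ closure (face σ) \ face σ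

namespace PolytopalMesh

variable {d : ℕ} {Ω : PolyhedralDomain d} {M F I : Type*}

/-- `𝓕_K`: the faces of the cell `K`. -/
def cellFaces (D : PolytopalMesh Ω M F) (K : M) : Set F := {σ | D.face σ ⊆ frontier (D.cell K)}

open Classical in
/-- `𝓥_K`: the nodes of the cell `K`. -/
noncomputable def cellNodes (D : PolytopalMesh Ω M F) (K : M) : Finset (Space d) :=
  D.nodes.filter (fun s => s ∈ closure (D.cell K))

open Classical in
/-- `𝓥_σ`: the nodes of the face `σ`. -/
noncomputable def faceNodes (D : PolytopalMesh Ω M F) (σ : F) : Finset (Space d) :=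
  D.nodes.filter (fun s => s ∈ closure (D.face σ))

/-- The measure `|K|`. -/
noncomputable def cellVol (D : PolytopalMesh Ω M F) (K : M) : ℝ := volume.real (D.cell K)

/-- The `(d-1)`-dimensional measure `|σ|`. -/
noncomputable def faceArea (D : PolytopalMesh Ω M F) (σ : F) : ℝ :=
  (μHE[d - 1] : Measure (Space d)).real (D.face σ)

/-- The center of mass of `K`. -/
noncomputable def cellCenter (D : PolytopalMesh Ω M F) (K : M) : Space d :=
  ⨍ x in D.cell K, x

/-- The center of mass of `σ`. -/
noncomputable def faceCenter (D : PolytopalMesh Ω M F) (σ : F) : Space d :=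
  ⨍ x in D.face σ, x ∂(μHE[d - 1] : Measure (Space d))

/-- `𝓕_Γ`: the faces lying on the fracture network. -/
def fractureFaces (D : PolytopalMesh Ω M F) (N : FractureNetwork Ω I) : Set F :=
  {σ | ∃ i, D.face σ ⊆ N.frac i}

/-- The mesh is conforming with the fracture network: `Γ̄` is the union of the closures of the
fracture faces. -/
def IsConforming (D : PolytopalMesh Ω M F) (N : FractureNetwork Ω I) : Prop :=
  N.closedNetwork = ⋃ σ ∈ D.fractureFaces N, closure (D.face σ)

/-- The normal `n⁺` on a fracture face: the one of the (unique) fracture containing the face. -/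
noncomputable def plusNormal (D : PolytopalMesh Ω M F) (N : FractureNetwork Ω I)
    (σ : D.fractureFaces N) : Space d :=
  N.normal σ.2.choose

/-- `𝓕⁺_{Γ,K}`: the fracture faces of `K` such that `n_{Kσ} · n⁺ > 0`. -/
def plusFaces (D : PolytopalMesh Ω M F) (N : FractureNetwork Ω I) (K : M) :
    Set (D.fractureFaces N) :=
  {σ | (σ : F) ∈ D.cellFaces K ∧ 0 < ⟪D.normal K σ, D.plusNormal N σ⟫_ℝ}

/-- The fracture faces of `L` such that `n_{Lσ} · n⁺ < 0`. -/
def minusFaces (D : PolytopalMesh Ω M F) (N : FractureNetwork Ω I) (L : M) :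
    Set (D.fractureFaces N) :=
  {σ | (σ : F) ∈ D.cellFaces L ∧ ⟪D.normal L σ, D.plusNormal N σ⟫_ℝ < 0}

end PolytopalMesh

/-! ### The two cells neighbouring a fracture face -/

theorem IsPolytopalIn.isOpen {d m : ℕ} {S : Set (Space d)} (h : IsPolytopalIn m univ S) :
    IsOpen S := by
  obtain ⟨T, -, -, rfl⟩ := h
  have : {x : Space d | x ∈ univ ∧ ∃ r > 0, Metric.ball x r ∩ univ ⊆ ⋃₀ T} = interior (⋃₀ T) := by
    ext x
    simp [mem_interior_iff_mem_nhds, Metric.mem_nhds_iff]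
  rw [this]
  exact isOpen_interior

theorem eq_or_eq_neg_of_orthogonal {d : ℕ} {ν n : Space d} (hν : ‖ν‖ = 1) (hn : ‖n‖ = 1)
    (h : ∀ t, ⟪ν, t⟫_ℝ = 0 → ⟪n, t⟫_ℝ = 0) : n = ν ∨ n = -ν := by
  have hνν : ⟪ν, ν⟫_ℝ = 1 := by rw [real_inner_self_eq_norm_sq, hν]; norm_num
  set a := ⟪ν, n⟫_ℝ with ha
  have h1 : ⟪ν, n - a • ν⟫_ℝ = 0 := by
    rw [inner_sub_right, inner_smul_right, hνν]; simp [ha]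
  have h2 := h _ h1
  have h3 : n - a • ν = 0 := by
    rw [← inner_self_eq_zero (𝕜 := ℝ), inner_sub_left, h2, inner_smul_left, h1]; simp
  have h4 : n = a • ν := sub_eq_zero.mp h3
  have h5 : |a| = 1 := by
    have := hn
    rwa [h4, norm_smul, hν, mul_one, Real.norm_eq_abs] at this
  rcases (abs_eq zero_le_one).mp h5 with h6 | h6
  · left; rw [h4, h6, one_smul]
  · right; rw [h4, h6, neg_smul, one_smul]

namespace PolytopalMesh

variable {d : ℕ} {Ω : PolyhedralDomain d} {M F I : Type*}

/-- Outward normals are normal to the plane of the face. -/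
theorem normal_eq (D : PolytopalMesh Ω M F) {K : M} {σ : F} (hK : σ ∈ D.cellFaces K)
    {ν : Space d} {c : ℝ} (hν : ‖ν‖ = 1) (hsub : D.face σ ⊆ {x | ⟪ν, x⟫_ℝ = c})
    {x : Space d} (hx : x ∈ D.face σ) {r : ℝ} (hr : 0 < r)
    (hball : Metric.ball x r ∩ {y | ⟪ν, y⟫_ℝ = c} ⊆ D.face σ) :
    D.normal K σ = ν ∨ D.normal K σ = -ν := by
  obtain ⟨hn, hloc⟩ := D.isOutwardNormal K σ hK
  refine eq_or_eq_neg_of_orthogonal hν hn ?_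
  obtain ⟨ρ, hρ, hball'⟩ := hloc x hx
  have key : ∀ t, ⟪ν, t⟫_ℝ = 0 → 0 ≤ ⟪D.normal K σ, t⟫_ℝ := by
    intro t ht
    obtain ⟨ε, hε, hεt⟩ : ∃ ε : ℝ, 0 < ε ∧ ε * ‖t‖ < min r ρ := by
      have hm : 0 < min r ρ := lt_min hr hρ
      refine ⟨min r ρ / (‖t‖ + 1), by positivity, ?_⟩
      rw [div_mul_eq_mul_div, div_lt_iff₀ (by positivity)]
      nlinarith
    have hd : dist (x + ε • t) x = ε * ‖t‖ := by
      rw [dist_eq_norm, add_sub_cancel_left, norm_smul, Real.norm_eq_abs, abs_of_pos hε]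
    have hmem : x + ε • t ∈ D.face σ := by
      refine hball ⟨?_, ?_⟩
      · rw [Metric.mem_ball, hd]; exact hεt.trans_le (min_le_left _ _)
      · have := hsub hx
        simp only [mem_ofPred_eq] at this ⊢
        rw [inner_add_right, inner_smul_right, ht, this]; simp
    have hnot : x + ε • t ∉ D.cell K := by
      have h1 := hK hmem
      rw [(D.cell_polytopal K).isOpen.frontier_eq] at h1
      exact h1.2
    have h2 : x + ε • t ∈ Metric.ball x ρ := by
      rw [Metric.mem_ball, hd]; exact hεt.trans_le (min_le_right _ _)
    rw [hball' _ h2, add_sub_cancel_left, inner_smul_left, not_lt] at hnot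
    rw [real_inner_comm]
    simpa [hε] using hnot
  intro t ht
  have h1 := key t ht
  have h2 := key (-t) (by rw [inner_neg_right, ht, neg_zero])
  rw [inner_neg_right] at h2
  linarith

theorem exists_plus_minus (D : PolytopalMesh Ω M F) (N : FractureNetwork Ω I)
    (σ : D.fractureFaces N) :
    (∃ K, σ ∈ D.plusFaces N K) ∧ ∃ L, σ ∈ D.minusFaces N L := by
  obtain ⟨x, hx⟩ := (D.face_connected σ).nonempty
  have hσi : D.face σ ⊆ N.frac σ.2.choose := σ.2.choose_spec
  obtain ⟨ν, c, hν, hsub, hopen⟩ := D.face_planar σ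
  obtain ⟨r, hr, hball⟩ := hopen x hx
  -- the normal of the fracture is normal to the plane of the face
  have hplus : D.plusNormal N σ = ν ∨ D.plusNormal N σ = -ν := by
    refine eq_or_eq_neg_of_orthogonal hν (N.norm_normal _) ?_
    intro t ht
    obtain ⟨ε, hε, hεt⟩ : ∃ ε : ℝ, 0 < ε ∧ ε * ‖t‖ < r := by
      refine ⟨r / (‖t‖ + 1), by positivity, ?_⟩
      rw [div_mul_eq_mul_div, div_lt_iff₀ (by positivity)]
      nlinarith
    have hmem : x + ε • t ∈ D.face σ := by
      refine hball ⟨?_, ?_⟩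
      · rw [Metric.mem_ball, dist_eq_norm, add_sub_cancel_left, norm_smul, Real.norm_eq_abs,
          abs_of_pos hε]
        exact hεt
      · have := hsub hx
        simp only [mem_ofPred_eq] at this ⊢
        rw [inner_add_right, inner_smul_right, ht, this]; simp
    have hpl : ∀ y ∈ D.face σ, ⟪D.plusNormal N σ, y⟫_ℝ = N.offset σ.2.choose := by
      intro y hy
      obtain ⟨T, -, -, hT⟩ := N.polytopal σ.2.choose
      have := hσi hy
      rw [hT] at this
      exact this.1
    have h1 := hpl _ hmem
    rw [inner_add_right, hpl _ hx, inner_smul_right] at h1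
    have : ε * ⟪D.plusNormal N σ, t⟫_ℝ = 0 := by linarith
    exact (mul_eq_zero.mp this).resolve_left hε.ne'
  have hνν : ⟪ν, ν⟫_ℝ = 1 := by rw [real_inner_self_eq_norm_sq, hν]; norm_num
  rcases D.face_adjacent σ with ⟨K, L, hKL, hK, hL⟩ | ⟨K, -, hbd⟩
  · have hnK := D.normal_eq (K := K) hK hν hsub hx hr hball
    have hnL := D.normal_eq (K := L) hL hν hsub hx hr hball
    have hne : D.normal K σ ≠ D.normal L σ := by
      intro heq
      obtain ⟨hn1, hK2⟩ := D.isOutwardNormal K σ hK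
      obtain ⟨-, hL2⟩ := D.isOutwardNormal L σ hL
      obtain ⟨ρ, hρ, hK3⟩ := hK2 x hx
      obtain ⟨ρ', hρ', hL3⟩ := hL2 x hx
      have hm : 0 < min ρ ρ' := lt_min hρ hρ'
      set y := x - (min ρ ρ' / 2) • D.normal K σ with hy
      have hdist : dist y x = min ρ ρ' / 2 := by
        rw [dist_eq_norm, hy, sub_sub_cancel_left, norm_neg, norm_smul, hn1, mul_one,
          Real.norm_eq_abs, abs_of_pos (by positivity)]
      have hin : ⟪y - x, D.normal K σ⟫_ℝ < 0 := by
        rw [hy, sub_sub_cancel_left, inner_neg_left, inner_smul_left,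
          real_inner_self_eq_norm_sq, hn1]
        simp [hm]
      have h1 : y ∈ D.cell K := (hK3 y (by
        rw [Metric.mem_ball, hdist]; linarith [min_le_left ρ ρ'])).2 hin
      have h2 : y ∈ D.cell L := (hL3 y (by
        rw [Metric.mem_ball, hdist]; linarith [min_le_right ρ ρ'])).2 (heq ▸ hin)
      exact Set.disjoint_left.mp (D.cell_disjoint hKL) h1 h2
    have hK' : (σ : F) ∈ D.cellFaces K := hK
    have hL' : (σ : F) ∈ D.cellFaces L := hL
    simp only [plusFaces, minusFaces, mem_ofPred_eq]
    rcases hnK with h1 | h1 <;> rcases hnL with h2 | h2 <;> rcases hplus with h3 | h3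
    all_goals first
      | exact absurd (h1.trans h2.symm) hne
      | (refine ⟨⟨K, hK', ?_⟩, ⟨L, hL', ?_⟩⟩ <;> norm_num [h1, h2, h3, hν]; done)
      | (refine ⟨⟨L, hL', ?_⟩, ⟨K, hK', ?_⟩⟩ <;> norm_num [h1, h2, h3, hν])
  · exfalso
    have h1 := hbd hx
    rw [Ω.polytopal.isOpen.frontier_eq] at h1
    exact h1.2 (N.subset_domain _ (hσi hx))

/-- The cell `K` on the positive side of a fracture face. -/
noncomputable def plusCell (D : PolytopalMesh Ω M F) (N : FractureNetwork Ω I)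
    (σ : D.fractureFaces N) : M :=
  (D.exists_plus_minus N σ).1.choose

/-- The cell `L` on the negative side of a fracture face. -/
noncomputable def minusCell (D : PolytopalMesh Ω M F) (N : FractureNetwork Ω I)
    (σ : D.fractureFaces N) : M :=
  (D.exists_plus_minus N σ).2.choose

/-! ### Discrete spaces -/

/-- The cells `K` and `L`, which contain the node `s`, lie on the same side of `Γ` at `s`: in each
neighbourhood of `s`, they meet a common connected component of the matrix `Ω \ Γ̄`. -/
def SameSide (D : PolytopalMesh Ω M F) (N : FractureNetwork Ω I) (s : Space d) (K L : M) : Prop :=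
  s ∈ closure (D.cell K) ∧ s ∈ closure (D.cell L) ∧
    ∀ r > 0, ∃ x ∈ D.cell K ∩ Metric.ball s r, ∃ y ∈ D.cell L ∩ Metric.ball s r,
      y ∈ connectedComponentIn ((Ω.carrier \ N.closedNetwork) ∩ Metric.ball s r) x

/-- Families of vectors: nodal values `v.1 K s = v_{𝒦s}` and bubble values `v.2 K σ = v_{Kσ}`. -/
abbrev DofFamily (D : PolytopalMesh Ω M F) (N : FractureNetwork Ω I) : Type _ :=
  (M → D.nodes → Space d) × (M → D.fractureFaces N → Space d)

/-- The space `U_{0,𝒟}` of discrete displacements: the components are `v_{𝒦s}` for `s ∈ 𝓥_K` and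
`v_{Kσ}` for `σ ∈ 𝓕⁺_{Γ,K}` (all other entries of the family are set to zero); the nodal values
vanish at the boundary nodes and coincide for cells on the same side of `Γ`. -/
def displacementSpace (D : PolytopalMesh Ω M F) (N : FractureNetwork Ω I) :
    Submodule ℝ (D.DofFamily N) where
  carrier := {v |
    (∀ K, ∀ s : D.nodes, (s : Space d) ∉ D.cellNodes K → v.1 K s = 0) ∧
    (∀ K σ, σ ∉ D.plusFaces N K → v.2 K σ = 0) ∧
    (∀ K, ∀ s : D.nodes, (s : Space d) ∈ frontier Ω.carrier → v.1 K s = 0) ∧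
    (∀ K L, ∀ s : D.nodes, D.SameSide N s K L → v.1 K s = v.1 L s)}
  zero_mem' := by simp
  add_mem' := by
    rintro v w ⟨a1, a2, a3, a4⟩ ⟨b1, b2, b3, b4⟩
    refine ⟨fun K s h => ?_, fun K s h => ?_, fun K s h => ?_, fun K L s h => ?_⟩
    · simp [a1 K s h, b1 K s h]
    · simp [a2 K s h, b2 K s h]
    · simp [a3 K s h, b3 K s h]
    · simp [a4 K L s h, b4 K L s h]
  smul_mem' := by
    rintro c v ⟨a1, a2, a3, a4⟩
    refine ⟨fun K s h => ?_, fun K s h => ?_, fun K s h => ?_, fun K L s h => ?_⟩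
    · simp [a1 K s h]
    · simp [a2 K s h]
    · simp [a3 K s h]
    · simp [a4 K L s h]

/-- The space `M_𝒟` of Lagrange multipliers, i.e. of vector fields on `Γ` that are constant on each
fracture face, identified with their face values. -/
abbrev MultiplierSpace (D : PolytopalMesh Ω M F) (N : FractureNetwork Ω I) : Type _ :=
  D.fractureFaces N → Space d

/-- The discrete dual cone `C_𝒟` for the (face-wise constant) Tresca threshold `g`. -/
def dualCone (D : PolytopalMesh Ω M F) (N : FractureNetwork Ω I)
    (g : D.fractureFaces N → ℝ) : Set (D.MultiplierSpace N) :=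
  {lam | ∀ σ, 0 ≤ ⟪lam σ, D.plusNormal N σ⟫_ℝ ∧
    ‖lam σ - ⟪lam σ, D.plusNormal N σ⟫_ℝ • D.plusNormal N σ‖ ≤ g σ}

/-! ### Reconstruction operators -/

/-- Nonnegative weights expressing the centers of mass of the faces and of the cells in terms of
their nodes. -/
structure Weights (D : PolytopalMesh Ω M F) where
  face : F → Space d → ℝ
  cell : M → Space d → ℝ
  face_nonneg : ∀ σ, ∀ s ∈ D.faceNodes σ, 0 ≤ face σ s
  face_sum : ∀ σ, ∑ s ∈ D.faceNodes σ, face σ s = 1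
  face_center : ∀ σ, ∑ s ∈ D.faceNodes σ, face σ s • s = D.faceCenter σ
  cell_nonneg : ∀ K, ∀ s ∈ D.cellNodes K, 0 ≤ cell K s
  cell_sum : ∀ K, ∑ s ∈ D.cellNodes K, cell K s = 1
  cell_center : ∀ K, ∑ s ∈ D.cellNodes K, cell K s • s = D.cellCenter K

open Classical in
/-- `v̄_{Kσ} = ∑_{s ∈ 𝓥_σ} ω_s^σ v_{𝒦s}`. -/
noncomputable def faceMean (D : PolytopalMesh Ω M F) (N : FractureNetwork Ω I) (W : D.Weights)
    (v : D.DofFamily N) (K : M) (σ : F) : Space d :=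
  ∑ s : D.nodes, if (s : Space d) ∈ D.faceNodes σ then W.face σ s • v.1 K s else 0

open Classical in
/-- `v̄_K = ∑_{s ∈ 𝓥_K} ω_s^K v_{𝒦s}`. -/
noncomputable def cellMean (D : PolytopalMesh Ω M F) (N : FractureNetwork Ω I) (W : D.Weights)
    (v : D.DofFamily N) (K : M) : Space d :=
  ∑ s : D.nodes, if (s : Space d) ∈ D.cellNodes K then W.cell K s • v.1 K s else 0

/-- The displacement jump on a fracture face, `v̄_{Kσ} - v̄_{Lσ} + v_{Kσ}` with `K` and `L` the cells
on the positive and negative sides. -/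
noncomputable def jump (D : PolytopalMesh Ω M F) (N : FractureNetwork Ω I) (W : D.Weights)
    (v : D.DofFamily N) (σ : D.fractureFaces N) : Space d :=
  D.faceMean N W v (D.plusCell N σ) σ - D.faceMean N W v (D.minusCell N σ) σ
    + v.2 (D.plusCell N σ) σ

open Classical in
/-- The gradient reconstruction `∇^K`; the tensor product is `(a ⊗ n)_{ij} = a_i n_j`. -/
noncomputable def grad [Fintype F] (D : PolytopalMesh Ω M F) (N : FractureNetwork Ω I)
    (W : D.Weights) (v : D.DofFamily N) (K : M) : Matrix (Fin d) (Fin d) ℝ :=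
  (1 / D.cellVol K) • (∑ σ : F, if σ ∈ D.cellFaces K then
      D.faceArea σ • Matrix.vecMulVec (D.faceMean N W v K σ).ofLp (D.normal K σ).ofLp else 0)
    + ∑ σ : D.fractureFaces N, if σ ∈ D.plusFaces N K then
      (D.faceArea σ / D.cellVol K) • Matrix.vecMulVec (v.2 K σ).ofLp (D.normal K σ).ofLp else 0

/-- The displacement reconstruction `Π^K v (x) = ∇^K v (x - x̄_K) + v̄_K`. -/
noncomputable def recon [Fintype F] (D : PolytopalMesh Ω M F) (N : FractureNetwork Ω I)
    (W : D.Weights) (v : D.DofFamily N) (K : M) (x : Space d) : Space d :=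
  Matrix.toEuclideanLin (D.grad N W v K) (x - D.cellCenter K) + D.cellMean N W v K

/-- The discrete symmetric gradient on the cell `K`. -/
noncomputable def strain [Fintype F] (D : PolytopalMesh Ω M F) (N : FractureNetwork Ω I)
    (W : D.Weights) (v : D.DofFamily N) (K : M) : Matrix (Fin d) (Fin d) ℝ :=
  (1 / 2 : ℝ) • (D.grad N W v K + (D.grad N W v K)ᵀ)

/-- The discrete stress on the cell `K`, for the values `mu`, `lam` of the Lamé coefficients. -/
noncomputable def stress [Fintype F] (D : PolytopalMesh Ω M F) (N : FractureNetwork Ω I)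
    (W : D.Weights) (mu lam : ℝ) (v : D.DofFamily N) (K : M) : Matrix (Fin d) (Fin d) ℝ :=
  (2 * mu) • D.strain N W v K
    + (lam * (D.strain N W v K).trace) • (1 : Matrix (Fin d) (Fin d) ℝ)

open Classical in
/-- The local stabilisation bilinear form `S_K`. -/
noncomputable def localStab [Fintype F] (D : PolytopalMesh Ω M F) (N : FractureNetwork Ω I)
    (W : D.Weights) (u v : D.DofFamily N) (K : M) : ℝ :=
  Metric.diam (D.cell K) ^ (d - 2) * (∑ s : D.nodes, if (s : Space d) ∈ D.cellNodes K then
      ⟪u.1 K s - D.recon N W u K s, v.1 K s - D.recon N W v K s⟫_ℝ else 0)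
    + Metric.diam (D.cell K) ^ (d - 2) * ∑ σ : D.fractureFaces N,
      if σ ∈ D.plusFaces N K then ⟪u.2 K σ, v.2 K σ⟫_ℝ else 0

/-- The scaled stabilisation form, with the averages of the Lamé coefficients on each cell. -/
noncomputable def scaledStab [Fintype M] [Fintype F] (D : PolytopalMesh Ω M F)
    (N : FractureNetwork Ω I) (W : D.Weights) (mu lam : Space d → ℝ) (u v : D.DofFamily N) : ℝ :=
  ∑ K : M, (2 * (⨍ x in D.cell K, mu x) + ⨍ x in D.cell K, lam x) * D.localStab N W u v K

/-- `∫_Ω σ_𝒟(u) : ε_𝒟(v)`, the integral being split over the cells. -/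
noncomputable def elasticity [Fintype M] [Fintype F] (D : PolytopalMesh Ω M F)
    (N : FractureNetwork Ω I) (W : D.Weights) (mu lam : Space d → ℝ) (u v : D.DofFamily N) : ℝ :=
  ∑ K : M, ∫ x in D.cell K,
    ∑ i, ∑ j, D.stress N W (mu x) (lam x) u K i j * D.strain N W v K i j

open Classical in
/-- `∫_Γ λ · ⟦v⟧_𝒟`, the integral being split over the fracture faces. -/
noncomputable def coupling [Fintype F] (D : PolytopalMesh Ω M F) (N : FractureNetwork Ω I)
    (W : D.Weights) (lam : D.MultiplierSpace N) (v : D.DofFamily N) : ℝ :=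
  ∑ σ : D.fractureFaces N,
    ∫ _x in D.face σ, ⟪lam σ, D.jump N W v σ⟫_ℝ ∂(μHE[d - 1] : Measure (Space d))

/-- `∫_Ω f · Π̃^𝒟 v`, the integral being split over the cells. -/
noncomputable def load [Fintype M] (D : PolytopalMesh Ω M F) (N : FractureNetwork Ω I)
    (W : D.Weights) (f : Space d → Space d) (v : D.DofFamily N) : ℝ :=
  ∑ K : M, ∫ x in D.cell K, ⟪f x, D.cellMean N W v K⟫_ℝ

/-- `(u, lam)`, in `U_{0,𝒟} × C_𝒟`, solves the discrete mixed variational problem with Lamé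
coefficients `mu`, `la`, Tresca threshold `g` and load `f`. -/
structure IsDiscreteSolution [Fintype M] [Fintype F] (D : PolytopalMesh Ω M F)
    (N : FractureNetwork Ω I) (W : D.Weights) (mu la : Space d → ℝ)
    (g : D.fractureFaces N → ℝ) (f : Space d → Space d)
    (u : D.displacementSpace N) (lam : D.MultiplierSpace N) : Prop where
  mem_cone : lam ∈ D.dualCone N g
  equilibrium : ∀ v : D.displacementSpace N,
    D.elasticity N W mu la u v + D.scaledStab N W mu la u v + D.coupling N W lam v
      = D.load N W f v
  inequality : ∀ m ∈ D.dualCone N g, D.coupling N W (m - lam) u ≤ 0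

end PolytopalMesh

/-!
The discrete problem is a saddle-point problem in finite dimension: a symmetric energy
`A(u, v) = ∫ σ(u) : ε(v) + S(u, v)`, a coupling `b(λ, v) = ∫_Γ λ · ⟦v⟧`, and a multiplier constrained
to the nonempty closed convex set `C_𝒟`. If `A` is positive definite and `b` is injective in `λ`, the
equilibrium equation determines `u = z - T λ`, where `z` and `T` represent the load and `b` in the
inner product `A`, and the variational inequality says that `T λ` is the projection of `z` onto the
closed convex set `T(C_𝒟)` (`existsUnique_saddlePoint`).

Injectivity of `b` comes from the bubbles: the displacement with bubbles `λ_σ` and no nodal values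
has jump `λ` (`jump_bubble`), and faces have positive and finite area (`faceArea_pos`).

Definiteness of `A` is a discrete Korn inequality (`eq_zero_of_strain_eq_zero`). Zero energy forces
the strains and the bubbles to vanish, and the nodal values of each cell to be those of an
infinitesimal rigid motion. Such a motion is zero as soon as it vanishes at the nodes of one face:
an extreme point of the closure of a face is a vertex, so that linear functionals attain their
extrema over a face at nodes (`eq_on_face_of_eq_on_nodes`), and a skew affine map vanishing on a
piece of a hyperplane is zero (`skew_affine_eq_zero`). Hence the motion is zero in a cell with a
boundary face, and this propagates through faces outside the network, at the nodes of which the two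
neighbouring cells share their values (`sameSide_of_face`).

That all cells are reached in this way (`eq_univ_of_closed_under_adjacency`) follows from the
connectedness of `Ω \ Γ̄`: the relative boundaries of the faces have zero `(d-1)`-dimensional measure,
so their projection along any direction is null, and almost every line in this direction crosses
the mesh through the faces proper (`exists_line_disjoint_of_null`).
-/

/-! ### Saddle points in finite dimension -/

/-- The saddle-point problem when the energy is the inner product itself. The equilibrium equation
forces `u = z - T m` where `z` represents `L` and `T` represents `b`, and the variational
inequality then says that `T m` is the projection of `z` onto the closed convex set `T '' C`. -/
theorem existsUnique_saddlePoint_inner {U M : Type*} [NormedAddCommGroup U]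
    [InnerProductSpace ℝ U] [FiniteDimensional ℝ U] [NormedAddCommGroup M] [NormedSpace ℝ M]
    [FiniteDimensional ℝ M] (b : M →ₗ[ℝ] U →ₗ[ℝ] ℝ) (hb : Function.Injective b)
    (L : U →ₗ[ℝ] ℝ) {C : Set M} (hne : C.Nonempty) (hcl : IsClosed C) (hconv : Convex ℝ C) :
    ∃! p : U × M, p.2 ∈ C ∧ (∀ v, ⟪p.1, v⟫_ℝ + b p.2 v = L v) ∧
      ∀ m ∈ C, b (m - p.2) p.1 ≤ 0 := by
  have : CompleteSpace U := FiniteDimensional.complete ℝ U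
  let riesz : (U →ₗ[ℝ] ℝ) →ₗ[ℝ] U :=
    ((InnerProductSpace.toDual ℝ U).symm.toLinearEquiv.toLinearMap).comp
      (LinearMap.toContinuousLinearMap (𝕜 := ℝ) (E := U) (F' := ℝ)).toLinearMap
  have hriesz : ∀ l v, ⟪riesz l, v⟫_ℝ = l v := by
    intro l v
    change ⟪(InnerProductSpace.toDual ℝ U).symm (LinearMap.toContinuousLinearMap l), v⟫_ℝ = _
    rw [InnerProductSpace.toDual_symm_apply]
    rfl
  let T : M →ₗ[ℝ] U := riesz.comp b
  have hT : ∀ m v, ⟪T m, v⟫_ℝ = b m v := fun m v => hriesz (b m) v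
  have hTinj : Function.Injective T := by
    intro m m' h
    apply hb
    ext v
    rw [← hT, ← hT, h]
  have hclosed : IsClosed (T '' C) :=
    (LinearMap.isClosedEmbedding_of_injective
      (LinearMap.ker_eq_bot.2 hTinj)).isClosedMap C hcl
  have hconv' : Convex ℝ (T '' C) := hconv.linear_image T
  obtain ⟨w, hwC, hw⟩ := exists_norm_eq_iInf_of_complete_convex (hne.image T)
    hclosed.isComplete hconv' (riesz L)
  rw [norm_eq_iInf_iff_real_inner_le_zero hconv' hwC] at hw
  obtain ⟨m₀, hm₀, rfl⟩ := hwC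
  refine ⟨(riesz L - T m₀, m₀), ⟨hm₀, fun v => ?_, fun m hm => ?_⟩, ?_⟩
  · simp only
    rw [inner_sub_left, hriesz, hT]; ring
  · simp only
    rw [← hT, real_inner_comm, map_sub]
    exact hw _ (mem_image_of_mem T hm)
  · rintro ⟨u, m⟩ ⟨hm, heq, hineq⟩
    simp only at hm heq hineq
    have hu : u = riesz L - T m := by
      refine ext_inner_right ℝ fun v => ?_
      rw [inner_sub_left, hriesz, hT]
      linarith [heq v]
    have h1 := hw _ (mem_image_of_mem T hm)
    have h2 := hineq m₀ hm₀
    rw [← hT, map_sub, real_inner_comm, hu] at h2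
    have h3 : ⟪T m - T m₀, T m - T m₀⟫_ℝ ≤ 0 := by
      have h4 : T m - T m₀ = (riesz L - T m₀) - (riesz L - T m) := by abel
      have h5 : ⟪riesz L - T m, T m - T m₀⟫_ℝ = -⟪riesz L - T m, T m₀ - T m⟫_ℝ := by
        rw [← inner_neg_right, neg_sub]
      calc ⟪T m - T m₀, T m - T m₀⟫_ℝ
          = ⟪(riesz L - T m₀) - (riesz L - T m), T m - T m₀⟫_ℝ := by rw [← h4]
        _ ≤ 0 := by rw [inner_sub_left, h5]; linarith
    have h6 : m = m₀ := hTinj (sub_eq_zero.1 (inner_self_eq_zero.1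
      (le_antisymm h3 real_inner_self_nonneg)))
    rw [hu, h6]

/-- Existence and uniqueness for a saddle-point problem with a symmetric positive definite energy
`A`, an injective coupling `b` (the inf-sup condition in finite dimension) and a multiplier
constrained to a closed convex set `C`. -/
theorem existsUnique_saddlePoint {U M : Type*} [AddCommGroup U] [Module ℝ U]
    [FiniteDimensional ℝ U] [NormedAddCommGroup M] [NormedSpace ℝ M] [FiniteDimensional ℝ M]
    (A : U →ₗ[ℝ] U →ₗ[ℝ] ℝ) (hsymm : ∀ u v, A u v = A v u) (hnonneg : ∀ u, 0 ≤ A u u)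
    (hdef : ∀ u, A u u = 0 → u = 0) (b : M →ₗ[ℝ] U →ₗ[ℝ] ℝ) (hb : Function.Injective b)
    (L : U →ₗ[ℝ] ℝ) {C : Set M} (hne : C.Nonempty) (hcl : IsClosed C) (hconv : Convex ℝ C) :
    ∃! p : U × M, p.2 ∈ C ∧ (∀ v, A p.1 v + b p.2 v = L v) ∧ ∀ m ∈ C, b (m - p.2) p.1 ≤ 0 := by
  let core : InnerProductSpace.Core ℝ U :=
    { inner := fun u v => A u v
      conj_inner_symm := fun u v => by simp [hsymm u v]
      re_inner_nonneg := fun u => by simpa using hnonneg u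
      add_left := fun u v w => by simp
      smul_left := fun u v r => by simp
      definite := hdef }
  let _ : NormedAddCommGroup U := core.toNormedAddCommGroup
  let _ : InnerProductSpace ℝ U := InnerProductSpace.ofCore core.toCore
  exact existsUnique_saddlePoint_inner b hb L hne hcl hconv

/-! ### Null sets, polytopal sets and vertices -/

/-- A set of zero `(d-1)`-dimensional measure projects onto a null set of the hyperplane orthogonal
to `e`, so that it is missed by the line in direction `e` through some point of any given nonempty
open set. -/
theorem exists_line_disjoint_of_null {d : ℕ} {E V : Set (Space d)}
    (hE : (μHE[d - 1] : Measure (Space d)) E = 0) (hV : IsOpen V) (hVne : V.Nonempty)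
    {e : Space d} (he : e ≠ 0) : ∃ p ∈ V, ∀ t : ℝ, p + t • e ∉ E := by
  let H : Submodule ℝ (Space d) := (ℝ ∙ e)ᗮ
  have hpos : 0 < d := by
    rcases Nat.eq_zero_or_pos d with rfl | h
    · exact absurd (Subsingleton.elim e 0) he
    · exact h
  have hrank : Module.finrank ℝ H = d - 1 := by
    have : Fact (Module.finrank ℝ (Space d) = (d - 1) + 1) :=
      ⟨by rw [finrank_euclideanSpace_fin]; omega⟩
    exact Submodule.finrank_orthogonal_span_singleton he
  let φ : Space d →L[ℝ] H := H.orthogonalProjectionOnto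
  have hφlip : LipschitzWith 1 φ := H.lipschitzWith_orthogonalProjectionOnto
  have hφsurj : Function.Surjective φ := fun y => ⟨y, by simp [φ]⟩
  have hφE : (volume : Measure H) (φ '' E) = 0 := by
    rw [← InnerProductSpace.euclideanHausdorffMeasure_eq_volume, hrank]
    rw [Measure.euclideanHausdorffMeasure_def] at hE ⊢
    have hc := Measure.addHaarScalarFactor_volume_hausdorffMeasure_ne_zero (d - 1)
    rw [Measure.smul_apply, smul_eq_zero] at hE ⊢
    right
    have h1 := hφlip.hausdorffMeasure_image_le (d := ((d - 1 : ℕ) : ℝ)) (by positivity) E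
    rw [hE.resolve_left hc, mul_zero] at h1
    exact le_antisymm h1 zero_le
  have hopen : IsOpen (φ '' V) := φ.isOpenMap hφsurj V hV
  have hVpos : 0 < (volume : Measure H) (φ '' V) := hopen.measure_pos _ (hVne.image _)
  have hnot : ¬ (φ '' V ⊆ φ '' E) := fun h => by
    have := measure_mono (μ := (volume : Measure H)) h
    rw [hφE] at this
    exact absurd hVpos (not_lt.2 this)
  obtain ⟨_, ⟨p, hp, rfl⟩, hpE⟩ := Set.not_subset.1 hnot
  refine ⟨p, hp, fun t ht => hpE ⟨p + t • e, ht, ?_⟩⟩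
  have he0 : φ e = 0 := by
    have : e ∈ Hᗮ := Submodule.le_orthogonal_orthogonal _ (Submodule.mem_span_singleton_self e)
    exact Submodule.orthogonalProjectionOnto_apply_of_mem_orthogonal this
  rw [map_add, map_smul, he0, smul_zero, add_zero]

/-- The subset `S` of the hyperplane is the isometric image of a bounded, nonempty, open subset of the
vector hyperplane orthogonal to `ν`, on which `μHE[d - 1]` is the Lebesgue measure. -/
theorem measure_hyperplane_pos_lt_top {d : ℕ} {S : Set (Space d)} {ν : Space d} {c : ℝ}
    (hν : ‖ν‖ = 1) (hS : S ⊆ {x | ⟪ν, x⟫_ℝ = c}) (hne : S.Nonempty) (hbdd : Bornology.IsBounded S)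
    (hopen : ∀ x ∈ S, ∃ r > 0, Metric.ball x r ∩ {y | ⟪ν, y⟫_ℝ = c} ⊆ S) :
    0 < (μHE[d - 1] : Measure (Space d)) S ∧ (μHE[d - 1] : Measure (Space d)) S < ⊤ := by
  obtain ⟨x, hx⟩ := hne
  have hν0 : ν ≠ 0 := fun h => by simp [h] at hν
  let H : Submodule ℝ (Space d) := (ℝ ∙ ν)ᗮ
  have hpos : 0 < d := by
    rcases Nat.eq_zero_or_pos d with rfl | h
    · exact absurd (Subsingleton.elim ν 0) hν0
    · exact h
  have hrank : Module.finrank ℝ H = d - 1 := by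
    have : Fact (Module.finrank ℝ (Space d) = (d - 1) + 1) :=
      ⟨by rw [finrank_euclideanSpace_fin]; omega⟩
    exact Submodule.finrank_orthogonal_span_singleton hν0
  have hH : ∀ w : Space d, w ∈ H ↔ ⟪ν, w⟫_ℝ = 0 := fun w =>
    Submodule.mem_orthogonal_singleton_iff_inner_right
  let ψ : H → Space d := fun w => x + w
  have hψ : Isometry ψ := Isometry.of_dist_eq fun a b => by
    simp only [ψ, dist_add_left]; rfl
  have himage : ψ '' (ψ ⁻¹' S) = S := by
    refine Set.image_preimage_eq_of_subset fun y hy => ⟨⟨y - x, ?_⟩, by simp [ψ]⟩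
    rw [hH, inner_sub_right]
    have h1 := hS hx
    have h2 := hS hy
    simp only [mem_ofPred_eq] at h1 h2
    rw [h1, h2, sub_self]
  have hmeas : (μHE[d - 1] : Measure (Space d)) S = (volume : Measure H) (ψ ⁻¹' S) := by
    rw [← InnerProductSpace.euclideanHausdorffMeasure_eq_volume, hrank,
      ← hψ.euclideanHausdorffMeasure_image, himage]
  have hopen' : IsOpen (ψ ⁻¹' S) := by
    rw [Metric.isOpen_iff]
    intro w hw
    obtain ⟨r, hr, hball⟩ := hopen _ hw
    refine ⟨r, hr, fun z hz => hball ⟨?_, ?_⟩⟩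
    · rw [Metric.mem_ball, hψ.dist_eq]; exact hz
    · have h1 := hS hx
      have h2 := (hH z).1 z.2
      simp only [mem_ofPred_eq] at h1 ⊢
      simp only [ψ]
      rw [inner_add_right, h1, h2, add_zero]
  rw [hmeas]
  refine ⟨hopen'.measure_pos _ ⟨0, by simpa [ψ] using hx⟩, ?_⟩
  exact (hψ.antilipschitz.isBounded_preimage hbdd).measure_lt_top

/-- A polytopal open set is regular open, as the interior of a closed set. -/
theorem IsPolytopalIn.interior_closure {d m : ℕ} {S : Set (Space d)}
    (h : IsPolytopalIn m univ S) : interior (closure S) = S := by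
  obtain ⟨T, hT, hsimp, rfl⟩ := h
  have hS : {x : Space d | x ∈ univ ∧ ∃ r > 0, Metric.ball x r ∩ univ ⊆ ⋃₀ T} = interior (⋃₀ T) := by
    ext x
    simp [mem_interior_iff_mem_nhds, Metric.mem_nhds_iff]
  have hclosed : IsClosed (⋃₀ T) := by
    rw [sUnion_eq_biUnion]
    refine hT.isClosed_biUnion fun Δ hΔ => ?_
    obtain ⟨p, -, -, rfl⟩ := hsimp Δ hΔ
    exact (finite_range p).isClosed_convexHull ℝ
  rw [hS]
  refine subset_antisymm (interior_mono ?_) (interior_maximal subset_closure isOpen_interior)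
  exact closure_minimal interior_subset hclosed

theorem IsPolytopalIn.isBounded {d m : ℕ} {H S : Set (Space d)}
    (h : IsPolytopalIn m H S) : Bornology.IsBounded S := by
  obtain ⟨T, hT, hsimp, rfl⟩ := h
  have hb : Bornology.IsBounded (⋃₀ T) := by
    refine (Bornology.isBounded_sUnion hT).2 fun Δ hΔ => ?_
    obtain ⟨p, -, -, rfl⟩ := hsimp Δ hΔ
    exact ((finite_range p).isCompact_convexHull ℝ).isBounded
  refine hb.subset ?_
  rintro x ⟨hx, r, hr, hsub⟩
  exact hsub ⟨Metric.mem_ball_self hr, hx⟩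

/-- At a non-vertex point `x` of `closure S`, a direction of local invariance gives a segment centred
at `x` and contained in `closure S`. -/
theorem isVertex_of_mem_extremePoints_closure {d : ℕ} {S : Set (Space d)} {x : Space d}
    (hx : x ∈ (closure S).extremePoints ℝ) : IsVertex S x := by
  refine ⟨hx.1, ?_⟩
  rintro w ⟨r, hr, hinv⟩
  by_contra hw
  obtain ⟨ε, hε, hεw⟩ : ∃ ε : ℝ, 0 < ε ∧ ε * ‖w‖ < r / 2 := by
    refine ⟨r / 2 / (‖w‖ + 1), by positivity, ?_⟩
    rw [div_mul_eq_mul_div, div_lt_iff₀ (by positivity)]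
    nlinarith [norm_nonneg w]
  have key : ∀ t : ℝ, |t| = ε → x + t • w ∈ closure S := by
    intro t ht
    rw [Metric.mem_closure_iff]
    intro δ hδ
    obtain ⟨y, hyS, hy⟩ := Metric.mem_closure_iff.1 hx.1 (min δ (r / 2)) (by positivity)
    have hyx : dist y x < r / 2 := by
      rw [dist_comm]; exact hy.trans_le (min_le_right _ _)
    refine ⟨y + t • w, (hinv y ?_ t ?_).1 hyS, ?_⟩
    · rw [Metric.mem_ball]; linarith
    · rw [Metric.mem_ball]
      have h1 : dist (y + t • w) y = ε * ‖w‖ := by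
        rw [dist_eq_norm, add_sub_cancel_left, norm_smul, Real.norm_eq_abs, ht]
      have := dist_triangle (y + t • w) y x
      linarith
    · rw [dist_add_right]
      exact hy.trans_le (min_le_left _ _)
  have h1 := key ε (abs_of_pos hε)
  have h2 := key (-ε) (by rw [abs_neg, abs_of_pos hε])
  have hmid : x ∈ openSegment ℝ (x + ε • w) (x + (-ε) • w) := by
    refine ⟨1 / 2, 1 / 2, by norm_num, by norm_num, by norm_num, ?_⟩
    module
  have h3 := hx.2 h1 h2 hmid
  have h4 : ε • w = 0 := by simpa using h3
  exact hw ((smul_eq_zero.1 h4).resolve_left hε.ne')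

/-- A linear functional `l` attains its maximum over the closure of a bounded set at a vertex, namely
at an extreme point of the compact set where `l` is maximal. -/
theorem le_of_forall_isVertex_le {d : ℕ} {S : Set (Space d)} (hbdd : Bornology.IsBounded S)
    (l : Space d →L[ℝ] ℝ) (c : ℝ) (h : ∀ x, IsVertex S x → l x ≤ c) :
    ∀ x ∈ closure S, l x ≤ c := by
  intro x hx
  have hcomp : IsCompact (closure S) := hbdd.isCompact_closure
  obtain ⟨y, hy, hmax⟩ := hcomp.exists_isMaxOn ⟨x, hx⟩ l.continuous.continuousOn
  let B : Set (Space d) := {z ∈ closure S | ∀ z' ∈ closure S, l z' ≤ l z}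
  have hexp : IsExposed ℝ (closure S) B := fun _ => ⟨l, rfl⟩
  have hBne : B.Nonempty := ⟨y, hy, fun z hz => hmax hz⟩
  obtain ⟨z, hz⟩ := (hexp.isCompact hcomp).extremePoints_nonempty hBne
  have hzB : z ∈ B := hz.1
  have hzv := isVertex_of_mem_extremePoints_closure
    (hexp.isExtreme.extremePoints_subset_extremePoints hz)
  exact (hzB.2 x hx).trans (h z hzv)

/-! ### Topology of the mesh -/

namespace PolytopalMesh

variable {d : ℕ} {Ω : PolyhedralDomain d} {M F I : Type*}

theorem isOpen_cell (D : PolytopalMesh Ω M F) (K : M) : IsOpen (D.cell K) :=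
  (D.cell_polytopal K).isOpen

theorem cell_subset_domain (D : PolytopalMesh Ω M F) (K : M) : D.cell K ⊆ Ω.carrier := by
  rw [← Ω.polytopal.interior_closure]
  refine interior_maximal ?_ (D.isOpen_cell K)
  rw [D.closure_domain]
  exact subset_closure.trans (subset_iUnion (fun K => closure (D.cell K)) K)

theorem mem_domain_of_ball_subset (D : PolytopalMesh Ω M F) {x : Space d} {r : ℝ} (hr : 0 < r)
    (h : Metric.ball x r ⊆ ⋃ K, closure (D.cell K)) : x ∈ Ω.carrier := by
  rw [← Ω.polytopal.interior_closure, mem_interior_iff_mem_nhds, D.closure_domain]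
  exact Filter.mem_of_superset (Metric.ball_mem_nhds x hr) h

theorem disjoint_cell_closure_face (D : PolytopalMesh Ω M F) (K : M) (σ : F) :
    Disjoint (D.cell K) (closure (D.face σ)) := by
  rw [Set.disjoint_left]
  intro x hxK hxσ
  have h1 : x ∈ ⋃ K, frontier (D.cell K) := by
    rw [D.skeleton]; exact mem_iUnion.2 ⟨σ, hxσ⟩
  obtain ⟨L, hL⟩ := mem_iUnion.1 h1
  rcases eq_or_ne K L with rfl | hKL
  · rw [(D.isOpen_cell K).frontier_eq] at hL
    exact hL.2 hxK
  · exact Set.disjoint_left.1 ((D.cell_disjoint hKL).closure_right (D.isOpen_cell K)) hxK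
      (frontier_subset_closure hL)

/-- The union of the relative boundaries of the faces, which plays the role of the skeleton of
codimension two. -/
def seam (D : PolytopalMesh Ω M F) : Set (Space d) := ⋃ σ, closure (D.face σ) \ D.face σ

theorem measure_seam [Finite F] (D : PolytopalMesh Ω M F) :
    (μHE[d - 1] : Measure (Space d)) D.seam = 0 :=
  measure_iUnion_null D.face_boundary_null

theorem exists_mem_face (D : PolytopalMesh Ω M F) {x : Space d} {K : M}
    (hx : x ∈ closure (D.cell K)) (hK : x ∉ D.cell K) (hseam : x ∉ D.seam) :
    ∃ σ, x ∈ D.face σ := by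
  have h1 : x ∈ ⋃ σ, closure (D.face σ) := by
    rw [← D.skeleton]
    exact mem_iUnion.2 ⟨K, by rw [(D.isOpen_cell K).frontier_eq]; exact ⟨hx, hK⟩⟩
  obtain ⟨σ, hσ⟩ := mem_iUnion.1 h1
  refine ⟨σ, ?_⟩
  by_contra h
  exact hseam (mem_iUnion.2 ⟨σ, hσ, h⟩)

/-- The outward normals of the two cells on either side of a face are different: otherwise the two
cells would share a half-ball. -/
theorem normal_ne (D : PolytopalMesh Ω M F) {K L : M} (hKL : K ≠ L) {σ : F}
    (hK : σ ∈ D.cellFaces K) (hL : σ ∈ D.cellFaces L) : D.normal K σ ≠ D.normal L σ := by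
  intro heq
  obtain ⟨x, hx⟩ := (D.face_connected σ).nonempty
  obtain ⟨hn1, hK2⟩ := D.isOutwardNormal K σ hK
  obtain ⟨-, hL2⟩ := D.isOutwardNormal L σ hL
  obtain ⟨ρ, hρ, hK3⟩ := hK2 x hx
  obtain ⟨ρ', hρ', hL3⟩ := hL2 x hx
  have hm : 0 < min ρ ρ' := lt_min hρ hρ'
  set y := x - (min ρ ρ' / 2) • D.normal K σ with hy
  have hdist : dist y x = min ρ ρ' / 2 := by
    rw [dist_eq_norm, hy, sub_sub_cancel_left, norm_neg, norm_smul, hn1, mul_one,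
      Real.norm_eq_abs, abs_of_pos (by positivity)]
  have hin : ⟪y - x, D.normal K σ⟫_ℝ < 0 := by
    rw [hy, sub_sub_cancel_left, inner_neg_left, inner_smul_left,
      real_inner_self_eq_norm_sq, hn1]
    simp [hm]
  have h1 : y ∈ D.cell K := (hK3 y (by
    rw [Metric.mem_ball, hdist]; linarith [min_le_left ρ ρ'])).2 hin
  have h2 : y ∈ D.cell L := (hL3 y (by
    rw [Metric.mem_ball, hdist]; linarith [min_le_right ρ ρ'])).2 (heq ▸ hin)
  exact Set.disjoint_left.mp (D.cell_disjoint hKL) h1 h2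

/-- Around a point of an interface, there is nothing but the two cells and the face. -/
theorem exists_ball_subset (D : PolytopalMesh Ω M F) {K L : M} (hKL : K ≠ L) {σ : F}
    (hK : σ ∈ D.cellFaces K) (hL : σ ∈ D.cellFaces L) {x : Space d} (hx : x ∈ D.face σ) :
    ∃ r > 0, Metric.ball x r ⊆ D.cell K ∪ D.cell L ∪ D.face σ := by
  obtain ⟨ν, c, hν, hsub, hopen⟩ := D.face_planar σ
  obtain ⟨r, hr, hball⟩ := hopen x hx
  obtain ⟨-, hK2⟩ := D.isOutwardNormal K σ hK
  obtain ⟨-, hL2⟩ := D.isOutwardNormal L σ hL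
  obtain ⟨ρ, hρ, hK3⟩ := hK2 x hx
  obtain ⟨ρ', hρ', hL3⟩ := hL2 x hx
  have hnK := D.normal_eq (K := K) hK hν hsub hx hr hball
  have hnL := D.normal_eq (K := L) hL hν hsub hx hr hball
  have hne := D.normal_ne hKL hK hL
  refine ⟨min r (min ρ ρ'), by positivity, fun y hy => ?_⟩
  have hyr : y ∈ Metric.ball x r := Metric.ball_subset_ball (min_le_left _ _) hy
  have hyρ : y ∈ Metric.ball x ρ :=
    Metric.ball_subset_ball ((min_le_right _ _).trans (min_le_left _ _)) hy
  have hyρ' : y ∈ Metric.ball x ρ' :=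
    Metric.ball_subset_ball ((min_le_right _ _).trans (min_le_right _ _)) hy
  have hxc := hsub hx
  simp only [mem_ofPred_eq] at hxc
  have hKy := (hK3 y hyρ).2
  have hLy := (hL3 y hyρ').2
  have hface : ⟪y - x, ν⟫_ℝ = 0 → y ∈ D.face σ := by
    intro h
    refine hball ⟨hyr, ?_⟩
    simp only [mem_ofPred_eq]
    rw [real_inner_comm, inner_sub_right, hxc] at h
    linarith
  rcases hnK with h1 | h1 <;> rcases hnL with h2 | h2
  · exact absurd (h1.trans h2.symm) hne
  · rw [h1] at hKy
    rw [h2, inner_neg_right] at hLy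
    rcases lt_trichotomy ⟪y - x, ν⟫_ℝ 0 with h | h | h
    · exact Or.inl (Or.inl (hKy h))
    · exact Or.inr (hface h)
    · exact Or.inl (Or.inr (hLy (by linarith)))
  · rw [h1, inner_neg_right] at hKy
    rw [h2] at hLy
    rcases lt_trichotomy ⟪y - x, ν⟫_ℝ 0 with h | h | h
    · exact Or.inl (Or.inr (hLy h))
    · exact Or.inr (hface h)
    · exact Or.inl (Or.inl (hKy (by linarith)))
  · exact absurd (h1.trans h2.symm) hne

theorem eq_or_eq_of_mem_closure_cell (D : PolytopalMesh Ω M F) {K L : M} (hKL : K ≠ L) {σ : F}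
    (hK : σ ∈ D.cellFaces K) (hL : σ ∈ D.cellFaces L) {x : Space d} (hx : x ∈ D.face σ)
    {J : M} (hJ : x ∈ closure (D.cell J)) : J = K ∨ J = L := by
  obtain ⟨r, hr, hball⟩ := D.exists_ball_subset hKL hK hL hx
  obtain ⟨y, hyJ, hyx⟩ := Metric.mem_closure_iff.1 hJ r hr
  by_contra! h
  rcases hball (by rwa [Metric.mem_ball, dist_comm] : y ∈ Metric.ball x r) with (hy | hy) | hy
  · exact Set.disjoint_left.1 (D.cell_disjoint h.1) hyJ hy
  · exact Set.disjoint_left.1 (D.cell_disjoint h.2) hyJ hy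
  · exact Set.disjoint_left.1 (D.disjoint_cell_closure_face J σ) hyJ (subset_closure hy)

theorem eq_of_mem_closure_face (D : PolytopalMesh Ω M F) {K L : M} (hKL : K ≠ L) {σ : F}
    (hK : σ ∈ D.cellFaces K) (hL : σ ∈ D.cellFaces L) {x : Space d} (hx : x ∈ D.face σ)
    {τ : F} (hτ : x ∈ closure (D.face τ)) : τ = σ := by
  obtain ⟨r, hr, hball⟩ := D.exists_ball_subset hKL hK hL hx
  obtain ⟨y, hyτ, hyx⟩ := Metric.mem_closure_iff.1 hτ r hr
  by_contra h
  rcases hball (by rwa [Metric.mem_ball, dist_comm] : y ∈ Metric.ball x r) with (hy | hy) | hy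
  · exact Set.disjoint_left.1 (D.disjoint_cell_closure_face K τ) hy (subset_closure hyτ)
  · exact Set.disjoint_left.1 (D.disjoint_cell_closure_face L τ) hy (subset_closure hyτ)
  · exact Set.disjoint_left.1 (D.face_disjoint h) hyτ hy

theorem face_subset_domain (D : PolytopalMesh Ω M F) {K L : M} (hKL : K ≠ L) {σ : F}
    (hK : σ ∈ D.cellFaces K) (hL : σ ∈ D.cellFaces L) : D.face σ ⊆ Ω.carrier := by
  intro x hx
  obtain ⟨r, hr, hball⟩ := D.exists_ball_subset hKL hK hL hx
  refine D.mem_domain_of_ball_subset hr fun y hy => ?_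
  rcases hball hy with (h | h) | h
  · exact mem_iUnion.2 ⟨K, subset_closure h⟩
  · exact mem_iUnion.2 ⟨L, subset_closure h⟩
  · exact mem_iUnion.2 ⟨K, frontier_subset_closure (hK h)⟩

theorem disjoint_cell_closedNetwork (D : PolytopalMesh Ω M F) {N : FractureNetwork Ω I}
    (hD : D.IsConforming N) (K : M) : Disjoint (D.cell K) N.closedNetwork := by
  rw [hD]
  simp only [disjoint_iUnion_right]
  exact fun σ _ => D.disjoint_cell_closure_face K σ

theorem notMem_closedNetwork (D : PolytopalMesh Ω M F) {N : FractureNetwork Ω I}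
    (hD : D.IsConforming N) {K L : M} (hKL : K ≠ L) {σ : F} (hσ : σ ∉ D.fractureFaces N)
    (hK : σ ∈ D.cellFaces K) (hL : σ ∈ D.cellFaces L) {x : Space d} (hx : x ∈ D.face σ) :
    x ∉ N.closedNetwork := by
  rw [hD]
  simp only [mem_iUnion, not_exists]
  intro τ hτ hxτ
  exact hσ (D.eq_of_mem_closure_face hKL hK hL hx hxτ ▸ hτ)

theorem notMem_fractureFaces (D : PolytopalMesh Ω M F) {N : FractureNetwork Ω I}
    {σ : F} {x : Space d} (hx : x ∈ D.face σ) (hxΓ : x ∉ N.closedNetwork) :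
    σ ∉ D.fractureFaces N := by
  rintro ⟨i, hi⟩
  exact hxΓ (subset_closure (mem_iUnion.2 ⟨i, hi hx⟩))

/-- Two cells that share a face outside the network are on the same side at the nodes of this face:
near the node, they are joined through a point of the face. -/
theorem sameSide_of_face (D : PolytopalMesh Ω M F) {N : FractureNetwork Ω I}
    (hD : D.IsConforming N) {K L : M} (hKL : K ≠ L) {σ : F} (hσ : σ ∉ D.fractureFaces N)
    (hK : σ ∈ D.cellFaces K) (hL : σ ∈ D.cellFaces L) {s : Space d}
    (hs : s ∈ closure (D.face σ)) : D.SameSide N s K L := by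
  have hKc : D.face σ ⊆ closure (D.cell K) := fun x hx => frontier_subset_closure (hK hx)
  have hLc : D.face σ ⊆ closure (D.cell L) := fun x hx => frontier_subset_closure (hL hx)
  refine ⟨closure_minimal hKc isClosed_closure hs, closure_minimal hLc isClosed_closure hs,
    fun r hr => ?_⟩
  obtain ⟨z, hz, hzs⟩ := Metric.mem_closure_iff.1 hs r hr
  have hU : IsOpen ((Ω.carrier \ N.closedNetwork) ∩ Metric.ball s r) :=
    (Ω.polytopal.isOpen.sdiff isClosed_closure).inter Metric.isOpen_ball
  have hzU : z ∈ (Ω.carrier \ N.closedNetwork) ∩ Metric.ball s r :=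
    ⟨⟨D.face_subset_domain hKL hK hL hz, D.notMem_closedNetwork hD hKL hσ hK hL hz⟩, by
      rwa [Metric.mem_ball, dist_comm]⟩
  obtain ⟨ρ, hρ, hball⟩ := Metric.isOpen_iff.1 hU z hzU
  obtain ⟨x, hxK, hxz⟩ := Metric.mem_closure_iff.1 (hKc hz) ρ hρ
  obtain ⟨y, hyL, hyz⟩ := Metric.mem_closure_iff.1 (hLc hz) ρ hρ
  rw [dist_comm, ← Metric.mem_ball] at hxz hyz
  exact ⟨x, ⟨hxK, (hball hxz).2⟩, y, ⟨hyL, (hball hyz).2⟩,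
    (convex_ball z ρ).isPreconnected.subset_connectedComponentIn hxz hball hyz⟩

/-- Any two cells are linked by a chain of cells sharing faces outside the network. Otherwise, the
closures of two complementary classes of cells would meet in `Ω \ Γ̄`, since this set is connected;
near a common point, a segment missing the seam would go from one class to the other across a
face outside the network. -/
theorem eq_univ_of_closed_under_adjacency [Finite M] [Finite F] (D : PolytopalMesh Ω M F)
    {N : FractureNetwork Ω I} (hΓ : IsConnected (Ω.carrier \ N.closedNetwork))
    (hD : D.IsConforming N) {S : Set M} (hne : S.Nonempty)
    (hS : ∀ K L σ, K ≠ L → σ ∉ D.fractureFaces N → σ ∈ D.cellFaces K → σ ∈ D.cellFaces L →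
      K ∈ S → L ∈ S) : S = univ := by
  by_contra hSne
  obtain ⟨L₀, hL₀⟩ := (Set.ne_univ_iff_exists_notMem S).1 hSne
  obtain ⟨K₀, hK₀⟩ := hne
  have hcl : ∀ S' : Set M, IsClosed (⋃ K ∈ S', closure (D.cell K)) := fun S' =>
    (Set.toFinite S').isClosed_biUnion fun _ _ => isClosed_closure
  have hcell : ∀ K, D.cell K ⊆ Ω.carrier \ N.closedNetwork := fun K x hx =>
    ⟨D.cell_subset_domain K hx, fun h => Set.disjoint_left.1 (D.disjoint_cell_closedNetwork hD K)
      hx h⟩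
  have hmeet : ∀ (S' : Set M) (K : M), K ∈ S' →
      ((Ω.carrier \ N.closedNetwork) ∩ ⋃ K ∈ S', closure (D.cell K)).Nonempty := by
    intro S' K hK
    obtain ⟨x, hx⟩ := (D.cell_connected K).nonempty
    exact ⟨x, hcell K hx, mem_biUnion hK (subset_closure hx)⟩
  have hcover : ∀ x ∈ Ω.carrier,
      x ∈ (⋃ K ∈ S, closure (D.cell K)) ∪ ⋃ K ∈ Sᶜ, closure (D.cell K) := by
    intro x hx
    have hx' : x ∈ ⋃ K, closure (D.cell K) := by
      rw [← D.closure_domain]; exact subset_closure hx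
    obtain ⟨K, hK⟩ := mem_iUnion.1 hx'
    by_cases hKS : K ∈ S
    · exact Or.inl (mem_biUnion hKS hK)
    · exact Or.inr (mem_biUnion (mem_compl hKS) hK)
  obtain ⟨x, hxU, hxS, hxS'⟩ := isPreconnected_closed_iff.1 hΓ.isPreconnected _ _ (hcl S) (hcl Sᶜ)
    (fun x hx => hcover x hx.1) (hmeet S K₀ hK₀) (hmeet Sᶜ L₀ hL₀)
  obtain ⟨r, hr, hball⟩ := Metric.isOpen_iff.1
    (Ω.polytopal.isOpen.sdiff (isClosed_closure (s := ⋃ i, N.frac i))) x hxU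
  simp only [mem_iUnion, exists_prop] at hxS hxS'
  obtain ⟨K, hKS, hxK⟩ := hxS
  obtain ⟨L, hLS, hxL⟩ := hxS'
  obtain ⟨p, hpK, hpx⟩ := Metric.mem_closure_iff.1 hxK r hr
  obtain ⟨q, hqL, hqx⟩ := Metric.mem_closure_iff.1 hxL r hr
  rw [dist_comm, ← Metric.mem_ball] at hpx hqx
  have hpq : q - p ≠ 0 := by
    intro h
    rw [sub_eq_zero] at h
    subst h
    have : K = L := by
      by_contra hKL
      exact Set.disjoint_left.1 (D.cell_disjoint hKL) hpK hqL
    exact hLS (this ▸ hKS)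
  -- the starting points near `p` from which translation by `q - p` leads to a point near `q`
  let V : Set (Space d) := (D.cell K ∩ Metric.ball x r) ∩
    (fun y => y + (q - p)) ⁻¹' (D.cell L ∩ Metric.ball x r)
  have hV : IsOpen V := ((D.isOpen_cell K).inter Metric.isOpen_ball).inter
    (((D.isOpen_cell L).inter Metric.isOpen_ball).preimage (by fun_prop))
  have hVne : V.Nonempty := ⟨p, ⟨hpK, hpx⟩, by simpa using ⟨hqL, Metric.mem_ball.1 hqx⟩⟩
  obtain ⟨p', ⟨⟨hp'K, hp'x⟩, hp'L, hp'x'⟩, hline⟩ :=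
    exists_line_disjoint_of_null D.measure_seam hV hVne hpq
  let seg : Set (Space d) := segment ℝ p' (p' + (q - p))
  have hsegball : seg ⊆ Metric.ball x r := (convex_ball x r).segment_subset hp'x hp'x'
  have hsegseam : ∀ y ∈ seg, y ∉ D.seam := by
    intro y hy
    simp only [seg, segment_eq_image'] at hy
    obtain ⟨t, -, rfl⟩ := hy
    simpa using hline t
  obtain ⟨y, hy, hyS, hyS'⟩ := isPreconnected_closed_iff.1
    (convex_segment p' (p' + (q - p))).isPreconnected _ _ (hcl S) (hcl Sᶜ)
    (fun y hy => hcover y (hball (hsegball hy)).1)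
    ⟨p', left_mem_segment ℝ _ _, mem_biUnion hKS (subset_closure hp'K)⟩
    ⟨_, right_mem_segment ℝ _ _, mem_biUnion hLS (subset_closure hp'L)⟩
  simp only [mem_iUnion, exists_prop] at hyS hyS'
  obtain ⟨K₁, hK₁S, hyK₁⟩ := hyS
  obtain ⟨K₂, hK₂S, hyK₂⟩ := hyS'
  have hne12 : K₁ ≠ K₂ := fun h => hK₂S (h ▸ hK₁S)
  have hynot : y ∉ D.cell K₁ := fun h =>
    Set.disjoint_left.1 ((D.cell_disjoint hne12).closure_right (D.isOpen_cell K₁)) h hyK₂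
  obtain ⟨σ, hσ⟩ := D.exists_mem_face hyK₁ hynot (hsegseam y hy)
  have hyU := hball (hsegball hy)
  have hσΓ := D.notMem_fractureFaces hσ hyU.2
  rcases D.face_adjacent σ with ⟨A, B, hAB, hA, hB⟩ | ⟨A, -, hA⟩
  · have h1 := D.eq_or_eq_of_mem_closure_cell hAB hA hB hσ hyK₁
    have h2 := D.eq_or_eq_of_mem_closure_cell hAB hA hB hσ hyK₂
    rcases h1 with rfl | rfl <;> rcases h2 with rfl | rfl
    · exact hne12 rfl
    · exact hK₂S (hS _ _ σ hne12 hσΓ hA hB hK₁S)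
    · exact hK₂S (hS _ _ σ hne12 hσΓ hB hA hK₁S)
    · exact hne12 rfl
  · have h1 := hA hσ
    rw [Ω.polytopal.isOpen.frontier_eq] at h1
    exact h1.2 hyU.1

/-- Some cell has a face on the boundary of the domain: a line missing the seam leaves the bounded
set `Ω` through a boundary face. -/
theorem exists_boundary_face [Finite F] (hd : 1 ≤ d) (D : PolytopalMesh Ω M F) :
    ∃ K, ∃ σ ∈ D.cellFaces K, D.face σ ⊆ frontier Ω.carrier := by
  let e : Space d := EuclideanSpace.single ⟨0, hd⟩ 1
  have he1 : ‖e‖ = 1 := by simp [e]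
  have he : e ≠ 0 := fun h => by simp [h] at he1
  obtain ⟨p, hp, hline⟩ := exists_line_disjoint_of_null D.measure_seam Ω.polytopal.isOpen
    Ω.connected.nonempty he
  let ℓ : Set (Space d) := range fun t : ℝ => p + t • e
  have hℓ : IsPreconnected ℓ := isPreconnected_range (by fun_prop)
  have hout : (ℓ ∩ Ω.carrierᶜ).Nonempty := by
    obtain ⟨R, hR⟩ := Ω.polytopal.isBounded.subset_ball p
    refine ⟨p + R • e, ⟨R, rfl⟩, fun h => ?_⟩
    have h1 := hR h
    rw [Metric.mem_ball, dist_eq_norm, add_sub_cancel_left, norm_smul, he1, mul_one,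
      Real.norm_eq_abs] at h1
    exact absurd h1 (not_lt.2 (le_abs_self R))
  obtain ⟨z, ⟨t, rfl⟩, hz⟩ := isPreconnected_closed_iff.1 hℓ (closure Ω.carrier) Ω.carrierᶜ
    isClosed_closure Ω.polytopal.isOpen.isClosed_compl
    (fun y _ => (em (y ∈ Ω.carrier)).imp (fun h => subset_closure h) id)
    ⟨p, ⟨0, by simp⟩, subset_closure hp⟩ hout
  have hzseam := hline t
  set z := p + t • e with hzdef
  have hzΩ : z ∉ Ω.carrier := hz.2
  have hzc : z ∈ ⋃ K, closure (D.cell K) := by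
    rw [← D.closure_domain]; exact hz.1
  obtain ⟨K, hK⟩ := mem_iUnion.1 hzc
  obtain ⟨σ, hσ⟩ := D.exists_mem_face hK (fun h => hzΩ (D.cell_subset_domain K h)) hzseam
  rcases D.face_adjacent σ with ⟨A, B, hAB, hA, hB⟩ | ⟨A, hA, hA'⟩
  · exact absurd (D.face_subset_domain hAB hA hB hσ) hzΩ
  · exact ⟨A, σ, hA, hA'⟩

theorem isBounded_face (D : PolytopalMesh Ω M F) (σ : F) : Bornology.IsBounded (D.face σ) := by
  have h : ∀ K, D.face σ ⊆ frontier (D.cell K) → Bornology.IsBounded (D.face σ) := fun K hK =>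
    (D.cell_polytopal K).isBounded.closure.subset (hK.trans frontier_subset_closure)
  rcases D.face_adjacent σ with ⟨K, -, -, hK, -⟩ | ⟨K, hK, -⟩
  · exact h K hK
  · exact h K hK

theorem faceArea_pos (D : PolytopalMesh Ω M F) (σ : F) : 0 < D.faceArea σ := by
  obtain ⟨ν, c, hν, hsub, hopen⟩ := D.face_planar σ
  obtain ⟨h1, h2⟩ := measure_hyperplane_pos_lt_top hν hsub (D.face_connected σ).nonempty
    (D.isBounded_face σ) hopen
  exact ENNReal.toReal_pos h1.ne' h2.ne

theorem measure_cell_lt_top (D : PolytopalMesh Ω M F) (K : M) : volume (D.cell K) < ⊤ :=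
  (D.cell_polytopal K).isBounded.measure_lt_top

theorem measure_cell_pos (D : PolytopalMesh Ω M F) (K : M) : 0 < volume (D.cell K) :=
  (D.isOpen_cell K).measure_pos _ (D.cell_connected K).nonempty

theorem diam_cell_pos (hd : 1 ≤ d) (D : PolytopalMesh Ω M F) (K : M) :
    0 < Metric.diam (D.cell K) := by
  have : Nonempty (Fin d) := ⟨⟨0, hd⟩⟩
  obtain ⟨x, hx⟩ := (D.cell_connected K).nonempty
  refine Metric.diam_pos ?_ (D.cell_polytopal K).isBounded
  exact (infinite_of_mem_nhds x ((D.isOpen_cell K).mem_nhds hx)).nontrivial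

/-- A linear functional that takes the value `c` at the nodes of a face takes it on the face. -/
theorem eq_on_face_of_eq_on_nodes (D : PolytopalMesh Ω M F) (σ : F) (l : Space d →L[ℝ] ℝ) (c : ℝ)
    (h : ∀ s ∈ D.faceNodes σ, l s = c) : ∀ x ∈ D.face σ, l x = c := by
  have hv : ∀ x, IsVertex (D.face σ) x → l x = c := fun x hx =>
    h x (by simpa [faceNodes] using ⟨D.vertex_mem_nodes σ x hx, hx.1⟩)
  intro x hx
  refine le_antisymm (le_of_forall_isVertex_le (D.isBounded_face σ) l c
    (fun y hy => (hv y hy).le) x (subset_closure hx)) ?_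
  have := le_of_forall_isVertex_le (D.isBounded_face σ) (-l) (-c)
    (fun y hy => by simp [hv y hy]) x (subset_closure hx)
  simpa using this

/-! ### Linearity of the discrete operators -/

section Linearity

variable (D : PolytopalMesh Ω M F) (N : FractureNetwork Ω I) (W : D.Weights)
  (u v w : D.DofFamily N) (r : ℝ) (K : M)

theorem faceMean_add (σ : F) :
    D.faceMean N W (u + v) K σ = D.faceMean N W u K σ + D.faceMean N W v K σ := by
  simp only [faceMean, ← Finset.sum_add_distrib]
  refine Finset.sum_congr rfl fun s _ => ?_
  split_ifs <;> simp

theorem faceMean_smul (σ : F) : D.faceMean N W (r • v) K σ = r • D.faceMean N W v K σ := by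
  simp only [faceMean, Finset.smul_sum]
  refine Finset.sum_congr rfl fun s _ => ?_
  split_ifs
  · simp [smul_comm r]
  · simp

theorem cellMean_add : D.cellMean N W (u + v) K = D.cellMean N W u K + D.cellMean N W v K := by
  simp only [cellMean, ← Finset.sum_add_distrib]
  refine Finset.sum_congr rfl fun s _ => ?_
  split_ifs <;> simp

theorem cellMean_smul : D.cellMean N W (r • v) K = r • D.cellMean N W v K := by
  simp only [cellMean, Finset.smul_sum]
  refine Finset.sum_congr rfl fun s _ => ?_
  split_ifs
  · simp [smul_comm r]
  · simp

theorem jump_add (σ : D.fractureFaces N) :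
    D.jump N W (u + v) σ = D.jump N W u σ + D.jump N W v σ := by
  simp only [jump, faceMean_add, Prod.snd_add, Pi.add_apply]
  abel

theorem jump_smul (σ : D.fractureFaces N) : D.jump N W (r • v) σ = r • D.jump N W v σ := by
  simp only [jump, faceMean_smul, Prod.smul_snd, Pi.smul_apply, smul_add, smul_sub]

variable [Fintype F]

theorem grad_add : D.grad N W (u + v) K = D.grad N W u K + D.grad N W v K := by
  simp only [grad]
  rw [add_add_add_comm, ← smul_add, ← Finset.sum_add_distrib, ← Finset.sum_add_distrib]
  congr 1
  · congr 1
    refine Finset.sum_congr rfl fun s _ => ?_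
    split_ifs
    · rw [faceMean_add, WithLp.ofLp_add, Matrix.add_vecMulVec, smul_add]
    · simp
  · refine Finset.sum_congr rfl fun s _ => ?_
    split_ifs
    · rw [Prod.snd_add, Pi.add_apply, Pi.add_apply, WithLp.ofLp_add, Matrix.add_vecMulVec, smul_add]
    · simp

theorem grad_smul : D.grad N W (r • v) K = r • D.grad N W v K := by
  simp only [grad]
  rw [smul_add, smul_comm r, Finset.smul_sum (r := r), Finset.smul_sum (r := r)]
  congr 1
  · congr 1
    refine Finset.sum_congr rfl fun s _ => ?_
    split_ifs
    · rw [faceMean_smul, WithLp.ofLp_smul, Matrix.smul_vecMulVec, smul_comm r]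
    · simp
  · refine Finset.sum_congr rfl fun s _ => ?_
    split_ifs
    · rw [Prod.smul_snd, Pi.smul_apply, Pi.smul_apply, WithLp.ofLp_smul, Matrix.smul_vecMulVec,
        smul_comm r]
    · simp

theorem recon_add (x : Space d) :
    D.recon N W (u + v) K x = D.recon N W u K x + D.recon N W v K x := by
  simp only [recon, grad_add, cellMean_add, map_add, LinearMap.add_apply]
  abel

theorem recon_smul (x : Space d) : D.recon N W (r • v) K x = r • D.recon N W v K x := by
  simp only [recon, grad_smul, cellMean_smul, map_smul, LinearMap.smul_apply, smul_add]

theorem strain_add : D.strain N W (u + v) K = D.strain N W u K + D.strain N W v K := by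
  simp only [strain, grad_add, Matrix.transpose_add, smul_add]
  abel

theorem strain_smul : D.strain N W (r • v) K = r • D.strain N W v K := by
  simp only [strain, grad_smul, Matrix.transpose_smul, smul_add, smul_comm r]

theorem localStab_comm : D.localStab N W u v K = D.localStab N W v u K := by
  simp only [localStab, real_inner_comm]

theorem localStab_add : D.localStab N W (u + v) w K =
    D.localStab N W u w K + D.localStab N W v w K := by
  simp only [localStab]
  have key : ∀ a a₁ a₂ b b₁ b₂ c : ℝ, a = a₁ + a₂ → b = b₁ + b₂ →
      c * a + c * b = c * a₁ + c * b₁ + (c * a₂ + c * b₂) := by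
    rintro _ a₁ a₂ _ b₁ b₂ c rfl rfl
    ring
  apply key <;> rw [← Finset.sum_add_distrib]
  · refine Finset.sum_congr rfl fun s _ => ?_
    split_ifs
    · rw [recon_add, ← inner_add_left]
      congr 1
      simp only [Prod.fst_add, Pi.add_apply]
      abel
    · simp
  · refine Finset.sum_congr rfl fun s _ => ?_
    split_ifs
    · rw [← inner_add_left]; rfl
    · simp

theorem localStab_smul : D.localStab N W (r • v) w K = r * D.localStab N W v w K := by
  simp only [localStab]
  have key : ∀ a a₁ b b₁ c : ℝ, a = r * a₁ → b = r * b₁ →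
      c * a + c * b = r * (c * a₁ + c * b₁) := by
    rintro _ a₁ _ b₁ c rfl rfl
    ring
  apply key <;> rw [Finset.mul_sum]
  · refine Finset.sum_congr rfl fun s _ => ?_
    split_ifs
    · rw [recon_smul, ← real_inner_smul_left, smul_sub]
      rfl
    · simp
  · refine Finset.sum_congr rfl fun s _ => ?_
    split_ifs
    · rw [← real_inner_smul_left]; rfl
    · simp

theorem localStab_self_nonneg : 0 ≤ D.localStab N W v v K := by
  have hdiam : 0 ≤ Metric.diam (D.cell K) ^ (d - 2) := pow_nonneg Metric.diam_nonneg _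
  refine add_nonneg (mul_nonneg hdiam ?_) (mul_nonneg hdiam ?_) <;>
  · refine Finset.sum_nonneg fun s _ => ?_
    split_ifs
    · exact real_inner_self_nonneg
    · exact le_rfl

/-- The stabilisation vanishes only if the nodal values are those of the affine reconstruction and
the bubbles are zero. -/
theorem eq_recon_of_localStab_self_eq_zero (hd : 1 ≤ d) (h : D.localStab N W v v K = 0) :
    (∀ s : D.nodes, (s : Space d) ∈ D.cellNodes K → v.1 K s = D.recon N W v K s) ∧
      ∀ σ ∈ D.plusFaces N K, v.2 K σ = 0 := by
  classical
  have hdiam : 0 < Metric.diam (D.cell K) ^ (d - 2) := pow_pos (D.diam_cell_pos hd K) _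
  have h1 : ∀ s : D.nodes, 0 ≤ if (s : Space d) ∈ D.cellNodes K then
      ⟪v.1 K s - D.recon N W v K s, v.1 K s - D.recon N W v K s⟫_ℝ else 0 := fun s => by
    split_ifs
    · exact real_inner_self_nonneg
    · exact le_rfl
  have h2 : ∀ σ : D.fractureFaces N, 0 ≤ if σ ∈ D.plusFaces N K then
      ⟪v.2 K σ, v.2 K σ⟫_ℝ else 0 := fun s => by
    split_ifs
    · exact real_inner_self_nonneg
    · exact le_rfl
  rw [localStab, ← mul_add, mul_eq_zero, or_iff_right hdiam.ne',
    add_eq_zero_iff_of_nonneg (Finset.sum_nonneg fun s _ => by convert h1 s)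
      (Finset.sum_nonneg fun σ _ => by convert h2 σ),
    Finset.sum_eq_zero_iff_of_nonneg fun s _ => by convert h1 s,
    Finset.sum_eq_zero_iff_of_nonneg fun σ _ => by convert h2 σ] at h
  refine ⟨fun s hs => ?_, fun σ hσ => ?_⟩
  · have := h.1 s (Finset.mem_univ _)
    rw [if_pos hs, inner_self_eq_zero] at this
    exact sub_eq_zero.1 this
  · have := h.2 σ (Finset.mem_univ _)
    rwa [if_pos hσ, inner_self_eq_zero] at this

end Linearity

/-! ### The energy -/

section Energy

variable [Fintype F] (D : PolytopalMesh Ω M F) (N : FractureNetwork Ω I) (W : D.Weights)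

theorem sum_stress_mul_strain (m l : ℝ) (u v : D.DofFamily N) (K : M) :
    ∑ i, ∑ j, D.stress N W m l u K i j * D.strain N W v K i j =
      m * (2 * ∑ i, ∑ j, D.strain N W u K i j * D.strain N W v K i j) +
        l * ((D.strain N W u K).trace * (D.strain N W v K).trace) := by
  have h1 : ∀ i, ∑ j, D.stress N W m l u K i j * D.strain N W v K i j =
      2 * m * ∑ j, D.strain N W u K i j * D.strain N W v K i j +
        l * (D.strain N W u K).trace * D.strain N W v K i i := by
    intro i
    simp only [stress, Matrix.add_apply, Matrix.smul_apply, smul_eq_mul, add_mul,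
      Finset.sum_add_distrib, Finset.mul_sum, Matrix.one_apply, mul_ite, mul_one, mul_zero,
      ite_mul, zero_mul, Finset.sum_ite_eq, Finset.mem_univ, if_true]
    congr 1
    exact Finset.sum_congr rfl fun j _ => by ring
  simp only [h1, Finset.sum_add_distrib, ← Finset.mul_sum]
  rw [Matrix.trace, Matrix.trace]
  simp only [Matrix.diag_apply]
  ring

theorem elasticity_eq [Fintype M] {mu la : Space d → ℝ} (hmu : IntegrableOn mu Ω.carrier)
    (hla : IntegrableOn la Ω.carrier) (u v : D.DofFamily N) :
    D.elasticity N W mu la u v = ∑ K : M,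
      ((∫ x in D.cell K, mu x) * (2 * ∑ i, ∑ j, D.strain N W u K i j * D.strain N W v K i j) +
        (∫ x in D.cell K, la x) * ((D.strain N W u K).trace * (D.strain N W v K).trace)) := by
  refine Finset.sum_congr rfl fun K _ => ?_
  have h1 := hmu.mono_set (D.cell_subset_domain K)
  have h2 := hla.mono_set (D.cell_subset_domain K)
  simp only [sum_stress_mul_strain]
  rw [integral_add (h1.mul_const _) (h2.mul_const _), integral_mul_const, integral_mul_const]

theorem elasticity_comm [Fintype M] {mu la : Space d → ℝ} (hmu : IntegrableOn mu Ω.carrier)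
    (hla : IntegrableOn la Ω.carrier) (u v : D.DofFamily N) :
    D.elasticity N W mu la u v = D.elasticity N W mu la v u := by
  simp only [elasticity_eq D N W hmu hla, mul_comm]

theorem elasticity_add [Fintype M] {mu la : Space d → ℝ} (hmu : IntegrableOn mu Ω.carrier)
    (hla : IntegrableOn la Ω.carrier) (u v w : D.DofFamily N) :
    D.elasticity N W mu la (u + v) w =
      D.elasticity N W mu la u w + D.elasticity N W mu la v w := by
  simp only [elasticity_eq D N W hmu hla, ← Finset.sum_add_distrib]
  refine Finset.sum_congr rfl fun K _ => ?_
  simp only [strain_add, Matrix.trace_add, Matrix.add_apply, add_mul, Finset.sum_add_distrib]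
  ring

theorem elasticity_smul [Fintype M] {mu la : Space d → ℝ} (hmu : IntegrableOn mu Ω.carrier)
    (hla : IntegrableOn la Ω.carrier) (r : ℝ) (v w : D.DofFamily N) :
    D.elasticity N W mu la (r • v) w = r * D.elasticity N W mu la v w := by
  simp only [elasticity_eq D N W hmu hla, Finset.mul_sum]
  refine Finset.sum_congr rfl fun K _ => ?_
  simp only [strain_smul, Matrix.trace_smul, Matrix.smul_apply, smul_eq_mul, mul_assoc,
    Finset.mul_sum, mul_add]
  congr 1
  · refine Finset.sum_congr rfl fun i _ => Finset.sum_congr rfl fun j _ => by ring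
  · ring

theorem scaledStab_comm [Fintype M] (mu la : Space d → ℝ) (u v : D.DofFamily N) :
    D.scaledStab N W mu la u v = D.scaledStab N W mu la v u := by
  simp only [scaledStab, D.localStab_comm N W u v]

theorem scaledStab_add [Fintype M] (mu la : Space d → ℝ) (u v w : D.DofFamily N) :
    D.scaledStab N W mu la (u + v) w =
      D.scaledStab N W mu la u w + D.scaledStab N W mu la v w := by
  simp only [scaledStab, localStab_add, mul_add, Finset.sum_add_distrib]

theorem scaledStab_smul [Fintype M] (mu la : Space d → ℝ) (r : ℝ) (v w : D.DofFamily N) :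
    D.scaledStab N W mu la (r • v) w = r * D.scaledStab N W mu la v w := by
  simp only [scaledStab, localStab_smul, Finset.mul_sum, mul_left_comm r]

/-- The discrete energy `∫ σ(u) : ε(v) + S(u, v)` as a bilinear form. -/
noncomputable def energy [Fintype M] {mu la : Space d → ℝ} (hmu : IntegrableOn mu Ω.carrier)
    (hla : IntegrableOn la Ω.carrier) :
    D.displacementSpace N →ₗ[ℝ] D.displacementSpace N →ₗ[ℝ] ℝ :=
  LinearMap.mk₂ ℝ (fun u v => D.elasticity N W mu la u v + D.scaledStab N W mu la u v)
    (fun u v w => by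
      simp only [Submodule.coe_add, elasticity_add D N W hmu hla, scaledStab_add]
      ring)
    (fun r v w => by
      simp only [Submodule.coe_smul, elasticity_smul D N W hmu hla, scaledStab_smul, smul_eq_mul]
      ring)
    (fun u v w => by
      simp only [D.elasticity_comm N W hmu hla u, D.scaledStab_comm N W _ _ u,
        Submodule.coe_add, elasticity_add D N W hmu hla, scaledStab_add]
      ring)
    (fun r v w => by
      simp only [D.elasticity_comm N W hmu hla v, D.scaledStab_comm N W _ _ v,
        Submodule.coe_smul, elasticity_smul D N W hmu hla, scaledStab_smul, smul_eq_mul]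
      ring)

theorem energy_comm [Fintype M] {mu la : Space d → ℝ} (hmu : IntegrableOn mu Ω.carrier)
    (hla : IntegrableOn la Ω.carrier) (u v : D.displacementSpace N) :
    D.energy N W hmu hla u v = D.energy N W hmu hla v u := by
  rw [energy, LinearMap.mk₂_apply, LinearMap.mk₂_apply, D.elasticity_comm N W hmu hla u,
    D.scaledStab_comm N W _ _ u]

end Energy

/-- With `2 m + d l > 0`, the Cauchy–Schwarz bound `tr(A)² ≤ d |A|²` makes the isotropic quadratic
form coercive. -/
theorem exists_coercive_isotropic {m l : ℝ} (hm : 0 < m) (hl : 0 < 2 * m + d * l) :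
    ∃ c > 0, ∀ A : Matrix (Fin d) (Fin d) ℝ,
      c * ∑ i, ∑ j, A i j * A i j ≤
        m * (2 * ∑ i, ∑ j, A i j * A i j) + l * (A.trace * A.trace) := by
  have htr : ∀ A : Matrix (Fin d) (Fin d) ℝ,
      A.trace * A.trace ≤ d * ∑ i, ∑ j, A i j * A i j := by
    intro A
    have h1 : (∑ i, A i i) ^ 2 ≤ (d : ℝ) * ∑ i, (A i i) ^ 2 := by
      simpa using sq_sum_le_card_mul_sum_sq (s := Finset.univ) (f := fun i => A i i)
    have h2 : ∑ i, (A i i) ^ 2 ≤ ∑ i, ∑ j, A i j * A i j := by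
      refine Finset.sum_le_sum fun i _ => ?_
      rw [sq]
      exact Finset.single_le_sum (f := fun j => A i j * A i j)
        (fun j _ => mul_self_nonneg _) (Finset.mem_univ i)
    rw [Matrix.trace, ← sq]
    exact h1.trans (mul_le_mul_of_nonneg_left h2 (Nat.cast_nonneg d))
  rcases le_total 0 l with h | h
  · refine ⟨2 * m, by positivity, fun A => ?_⟩
    have := mul_nonneg h (mul_self_nonneg A.trace)
    linarith
  · refine ⟨2 * m + d * l, hl, fun A => ?_⟩
    have := mul_le_mul_of_nonpos_left (htr A) h
    linarith

/-- A skew affine map that vanishes on a nonempty relatively open subset of a hyperplane is zero: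
the linear part kills the directions of the hyperplane, and skewness kills the normal. -/
theorem skew_affine_eq_zero {G : Space d →ₗ[ℝ] Space d} (hG : ∀ x y, ⟪G x, y⟫_ℝ = -⟪x, G y⟫_ℝ)
    {b ν x : Space d} {c r : ℝ} (hν : ‖ν‖ = 1) (hr : 0 < r) (hx : ⟪ν, x⟫_ℝ = c)
    (h : ∀ y ∈ Metric.ball x r ∩ {y | ⟪ν, y⟫_ℝ = c}, G y + b = 0) : G = 0 ∧ b = 0 := by
  have hx0 := h x ⟨Metric.mem_ball_self hr, hx⟩
  have htan : ∀ t, ⟪ν, t⟫_ℝ = 0 → G t = 0 := by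
    intro t ht
    obtain ⟨ε, hε, hεt⟩ : ∃ ε : ℝ, 0 < ε ∧ ε * ‖t‖ < r := by
      refine ⟨r / (‖t‖ + 1), by positivity, ?_⟩
      rw [div_mul_eq_mul_div, div_lt_iff₀ (by positivity)]
      nlinarith
    have h1 := h (x + ε • t) ⟨by
      rwa [Metric.mem_ball, dist_eq_norm, add_sub_cancel_left, norm_smul, Real.norm_eq_abs,
        abs_of_pos hε], by
      simp only [mem_ofPred_eq]
      rw [inner_add_right, inner_smul_right, ht, hx, mul_zero, add_zero]⟩
    rw [map_add, map_smul, add_right_comm, hx0, zero_add] at h1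
    exact (smul_eq_zero.1 h1).resolve_left hε.ne'
  have hνν : ⟪ν, ν⟫_ℝ = 1 := by rw [real_inner_self_eq_norm_sq, hν]; norm_num
  have hdec : ∀ y : Space d, G y = ⟪ν, y⟫_ℝ • G ν := by
    intro y
    have h1 := htan (y - ⟪ν, y⟫_ℝ • ν) (by
      rw [inner_sub_right, inner_smul_right, hνν, mul_one, sub_self])
    rwa [map_sub, map_smul, sub_eq_zero] at h1
  have hGν : G ν = 0 := by
    have h1 : ⟪ν, G ν⟫_ℝ = 0 := by
      have := hG ν ν
      rw [real_inner_comm] at this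
      linarith
    rw [← inner_self_eq_zero (𝕜 := ℝ), hG, hdec (G ν), h1, zero_smul, inner_zero_right, neg_zero]
  have hG0 : G = 0 := by
    ext1 y
    rw [hdec, hGν, smul_zero, LinearMap.zero_apply]
  refine ⟨hG0, ?_⟩
  rwa [hG0, LinearMap.zero_apply, zero_add] at hx0

theorem inner_toEuclideanLin_of_skew {A : Matrix (Fin d) (Fin d) ℝ} (hA : A + Aᵀ = 0)
    (x y : Space d) : ⟪Matrix.toEuclideanLin A x, y⟫_ℝ = -⟪x, Matrix.toEuclideanLin A y⟫_ℝ := by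
  have h1 : Aᵀ = -A := (neg_eq_of_add_eq_zero_right hA).symm
  have h2 := Matrix.toEuclideanLin_conjTranspose_eq_adjoint A
  rw [Matrix.conjTranspose_eq_transpose_of_trivial, h1, map_neg] at h2
  rw [← LinearMap.adjoint_inner_right, ← h2, LinearMap.neg_apply, inner_neg_right]

/-! ### Discrete Korn inequality -/

theorem mem_cellNodes_of_mem_faceNodes (D : PolytopalMesh Ω M F) {K : M} {σ : F}
    (hσ : σ ∈ D.cellFaces K) {s : Space d} (hs : s ∈ D.faceNodes σ) : s ∈ D.cellNodes K := by
  simp only [faceNodes, cellNodes, Finset.mem_filter] at hs ⊢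
  exact ⟨hs.1, closure_minimal (hσ.trans frontier_subset_closure) isClosed_closure hs.2⟩

/-- A strain-free reconstruction that vanishes at the nodes of one face vanishes identically, since
the nodes of a face affinely span its hyperplane. -/
theorem recon_eq_zero_of_faceNodes [Fintype F] (D : PolytopalMesh Ω M F)
    (N : FractureNetwork Ω I) (W : D.Weights) (v : D.DofFamily N) {K : M}
    (hstrain : D.strain N W v K = 0) (σ : F)
    (h : ∀ s ∈ D.faceNodes σ, D.recon N W v K s = 0) (x : Space d) :
    D.recon N W v K x = 0 := by
  have hA : D.grad N W v K + (D.grad N W v K)ᵀ = 0 := by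
    rw [strain, smul_eq_zero] at hstrain
    exact hstrain.resolve_left (by norm_num)
  let G : Space d →ₗ[ℝ] Space d := Matrix.toEuclideanLin (D.grad N W v K)
  let b : Space d := D.cellMean N W v K - G (D.cellCenter K)
  have hrecon : ∀ y, D.recon N W v K y = G y + b := by
    intro y
    simp only [recon, map_sub, G, b]
    abel
  have hface : ∀ y ∈ D.face σ, G y + b = 0 := by
    intro y hy
    refine ext_inner_left ℝ fun a => ?_
    let l : Space d →L[ℝ] ℝ := (innerSL ℝ a).comp (LinearMap.toContinuousLinearMap G)
    have hl : ∀ z, l z = ⟪a, G z⟫_ℝ := fun z => rfl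
    have h1 := D.eq_on_face_of_eq_on_nodes σ l (-⟪a, b⟫_ℝ) (fun s hs => by
      have := h s hs
      rw [hrecon] at this
      rw [hl, eq_neg_of_add_eq_zero_left this, inner_neg_right]) y hy
    rw [inner_add_right, ← hl, h1, inner_zero_right, neg_add_cancel]
  obtain ⟨ν, c, hν, hsub, hopen⟩ := D.face_planar σ
  obtain ⟨z, hz⟩ := (D.face_connected σ).nonempty
  obtain ⟨r, hr, hball⟩ := hopen z hz
  obtain ⟨hG, hb⟩ := skew_affine_eq_zero (fun x y => inner_toEuclideanLin_of_skew hA x y) hν hr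
    (hsub hz) fun y hy => hface y (hball hy)
  rw [hrecon, hb, add_zero, show G = 0 from hG, LinearMap.zero_apply]

/-- A discrete displacement that is strain-free in each cell, whose nodal values are those of its
reconstruction and whose bubbles vanish, is zero: it vanishes in a cell that touches the boundary,
and from there in all cells. -/
theorem eq_zero_of_strain_eq_zero [Finite M] [Fintype F] (hd : 1 ≤ d) (D : PolytopalMesh Ω M F)
    {N : FractureNetwork Ω I} (hΓ : IsConnected (Ω.carrier \ N.closedNetwork))
    (hD : D.IsConforming N) (W : D.Weights) (v : D.displacementSpace N)
    (hstrain : ∀ K, D.strain N W v K = 0)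
    (hnode : ∀ K, ∀ s : D.nodes, (s : Space d) ∈ D.cellNodes K →
      (v : D.DofFamily N).1 K s = D.recon N W v K s)
    (hbubble : ∀ K, ∀ σ ∈ D.plusFaces N K, (v : D.DofFamily N).2 K σ = 0) : v = 0 := by
  obtain ⟨hv1, hv2, hv3, hv4⟩ := v.2
  have hnodes : ∀ {σ : F} {s : Space d}, s ∈ D.faceNodes σ →
      s ∈ D.nodes ∧ s ∈ closure (D.face σ) := by
    intro σ s hs
    simpa [faceNodes] using hs
  obtain ⟨K₀, σ₀, hσ₀, hbd⟩ := D.exists_boundary_face hd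
  have hall : {K | ∀ x, D.recon N W v K x = 0} = univ := by
    refine D.eq_univ_of_closed_under_adjacency hΓ hD ⟨K₀, ?_⟩ ?_
    · refine D.recon_eq_zero_of_faceNodes N W v (hstrain K₀) σ₀ fun s hs => ?_
      obtain ⟨hs1, hs2⟩ := hnodes hs
      rw [← hnode K₀ ⟨s, hs1⟩ (D.mem_cellNodes_of_mem_faceNodes hσ₀ hs)]
      exact hv3 K₀ ⟨s, hs1⟩ (closure_minimal hbd isClosed_frontier hs2)
    · intro K L σ hKL hσ hK hL hKS
      refine D.recon_eq_zero_of_faceNodes N W v (hstrain L) σ fun s hs => ?_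
      obtain ⟨hs1, hs2⟩ := hnodes hs
      rw [← hnode L ⟨s, hs1⟩ (D.mem_cellNodes_of_mem_faceNodes hL hs),
        ← hv4 K L ⟨s, hs1⟩ (D.sameSide_of_face hD hKL hσ hK hL hs2),
        hnode K ⟨s, hs1⟩ (D.mem_cellNodes_of_mem_faceNodes hK hs)]
      exact hKS s
  have hzero : ∀ K x, D.recon N W v K x = 0 := fun K => Set.eq_univ_iff_forall.1 hall K
  refine Subtype.ext (Prod.ext ?_ ?_)
  · funext K s
    by_cases hs : (s : Space d) ∈ D.cellNodes K
    · rw [hnode K s hs, hzero]; rfl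
    · exact hv1 K s hs
  · funext K σ
    by_cases hσ : σ ∈ D.plusFaces N K
    · exact hbubble K σ hσ
    · exact hv2 K σ hσ

/-! ### Positivity of the energy -/

theorem setIntegral_cell_pos (D : PolytopalMesh Ω M F)
    {h : Space d → ℝ} (hint : IntegrableOn h Ω.carrier)
    (hpos : ∀ᵐ x ∂volume.restrict Ω.carrier, 0 < h x) (K : M) : 0 < ∫ x in D.cell K, h x := by
  have hK := D.cell_subset_domain K
  have hpos' : ∀ᵐ x ∂volume.restrict (D.cell K), 0 < h x :=
    ae_restrict_of_ae_restrict_of_subset hK hpos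
  rw [integral_pos_iff_support_of_nonneg_ae (hpos'.mono fun x hx => hx.le) (hint.mono_set hK)]
  have h1 : volume.restrict (D.cell K) (Function.support h)ᶜ = 0 :=
    measure_mono_null (fun x hx hx' => hx (ne_of_gt hx')) hpos'
  have h2 : volume.restrict (D.cell K) univ ≤ volume.restrict (D.cell K) (Function.support h) := by
    rw [← union_compl_self (Function.support h)]
    exact (measure_union_le _ _).trans (by rw [h1, add_zero])
  refine lt_of_lt_of_le ?_ h2
  rw [Measure.restrict_apply_univ]
  exact D.measure_cell_pos K

section Positivity

variable [Fintype M] [Fintype F] (D : PolytopalMesh Ω M F) (N : FractureNetwork Ω I)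
  (W : D.Weights) {mu la : Space d → ℝ}

/-- The energy splits over the cells into a coercive function of the strain and a positive multiple
of the local stabilisation. -/
theorem energy_self_cellwise (hd : 1 ≤ d) (hmu : IntegrableOn mu Ω.carrier)
    (hla : IntegrableOn la Ω.carrier)
    (hmu_pos : ∀ᵐ x ∂volume.restrict Ω.carrier, 0 < mu x)
    (hla_pos : ∀ᵐ x ∂volume.restrict Ω.carrier, 0 < 2 * mu x + d * la x) :
    ∃ c e : M → ℝ, (∀ K, 0 < c K) ∧ (∀ K, 0 < e K) ∧ ∀ v : D.displacementSpace N,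
      ∑ K, (c K * ∑ i, ∑ j, D.strain N W v K i j * D.strain N W v K i j +
        e K * D.localStab N W v v K) ≤ D.energy N W hmu hla v v := by
  have hm : ∀ K, 0 < ∫ x in D.cell K, mu x := D.setIntegral_cell_pos hmu hmu_pos
  have hl : ∀ K, 0 < 2 * (∫ x in D.cell K, mu x) + d * ∫ x in D.cell K, la x := by
    intro K
    have h1 := D.setIntegral_cell_pos ((hmu.const_mul 2).add (hla.const_mul (d : ℝ))) hla_pos K
    have hK := D.cell_subset_domain K
    simp only [Pi.add_apply] at h1
    rwa [integral_add ((hmu.mono_set hK).const_mul 2) ((hla.mono_set hK).const_mul (d : ℝ)),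
      integral_const_mul, integral_const_mul] at h1
  have hpos : ∀ K, 0 < 2 * (⨍ x in D.cell K, mu x) + ⨍ x in D.cell K, la x := by
    intro K
    have h1 : 0 < 2 * (∫ x in D.cell K, mu x) + ∫ x in D.cell K, la x := by
      rcases le_total 0 (∫ x in D.cell K, la x) with h | h
      · linarith [hm K]
      · have hd' : (1 : ℝ) ≤ d := by exact_mod_cast hd
        nlinarith [hl K]
    have h2 : 0 < volume.real (D.cell K) :=
      ENNReal.toReal_pos (D.measure_cell_pos K).ne' (D.measure_cell_lt_top K).ne
    rw [setAverage_eq, setAverage_eq, smul_eq_mul, smul_eq_mul, mul_left_comm, ← mul_add]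
    positivity
  choose c hc hcoer using fun K => exists_coercive_isotropic (d := d) (hm K) (hl K)
  refine ⟨c, _, hc, hpos, fun v => ?_⟩
  rw [energy, LinearMap.mk₂_apply, elasticity_eq D N W hmu hla, scaledStab,
    ← Finset.sum_add_distrib]
  exact Finset.sum_le_sum fun K _ => add_le_add_left (hcoer K _) _

theorem energy_self_nonneg_and_definite (hd : 1 ≤ d)
    (hΓ : IsConnected (Ω.carrier \ N.closedNetwork)) (hD : D.IsConforming N)
    (hmu : IntegrableOn mu Ω.carrier) (hla : IntegrableOn la Ω.carrier)
    (hmu_pos : ∀ᵐ x ∂volume.restrict Ω.carrier, 0 < mu x)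
    (hla_pos : ∀ᵐ x ∂volume.restrict Ω.carrier, 0 < 2 * mu x + d * la x)
    (v : D.displacementSpace N) :
    0 ≤ D.energy N W hmu hla v v ∧ (D.energy N W hmu hla v v = 0 → v = 0) := by
  obtain ⟨c, e, hc, he, hle⟩ := D.energy_self_cellwise N W hd hmu hla hmu_pos hla_pos
  have hsq : ∀ K, 0 ≤ ∑ i, ∑ j, D.strain N W v K i j * D.strain N W v K i j := fun K =>
    Finset.sum_nonneg fun i _ => Finset.sum_nonneg fun j _ => mul_self_nonneg _
  have hstab : ∀ K, 0 ≤ D.localStab N W v v K := fun K => D.localStab_self_nonneg N W v K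
  have hterm1 : ∀ K, 0 ≤ c K * ∑ i, ∑ j, D.strain N W v K i j * D.strain N W v K i j :=
    fun K => mul_nonneg (hc K).le (hsq K)
  have hterm2 : ∀ K, 0 ≤ e K * D.localStab N W v v K := fun K => mul_nonneg (he K).le (hstab K)
  have hterm := fun K => add_nonneg (hterm1 K) (hterm2 K)
  refine ⟨(Finset.sum_nonneg fun K _ => hterm K).trans (hle v), fun h0 => ?_⟩
  have h1 := le_antisymm ((hle v).trans h0.le) (Finset.sum_nonneg fun K _ => hterm K)
  rw [Finset.sum_eq_zero_iff_of_nonneg fun K _ => hterm K] at h1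
  have h2 : ∀ K, c K * ∑ i, ∑ j, D.strain N W v K i j * D.strain N W v K i j = 0 ∧
      e K * D.localStab N W v v K = 0 := fun K =>
    (add_eq_zero_iff_of_nonneg (hterm1 K) (hterm2 K)).1 (h1 K (Finset.mem_univ K))
  have h3 : ∀ K, D.localStab N W v v K = 0 := fun K =>
    (mul_eq_zero.1 (h2 K).2).resolve_left (he K).ne'
  have h4 := fun K => D.eq_recon_of_localStab_self_eq_zero N W v K hd (h3 K)
  refine D.eq_zero_of_strain_eq_zero hd hΓ hD W v (fun K => ?_) (fun K => (h4 K).1)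
    fun K => (h4 K).2
  have h5 := (mul_eq_zero.1 (h2 K).1).resolve_left (hc K).ne'
  ext i j
  have h6 := (Finset.sum_eq_zero_iff_of_nonneg fun i _ => Finset.sum_nonneg fun j _ =>
    mul_self_nonneg (D.strain N W v K i j)).1 h5 i (Finset.mem_univ i)
  exact mul_self_eq_zero.1 ((Finset.sum_eq_zero_iff_of_nonneg fun j _ =>
    mul_self_nonneg (D.strain N W v K i j)).1 h6 j (Finset.mem_univ j))

end Positivity

/-! ### Coupling, load and dual cone -/

section Coupling

variable (D : PolytopalMesh Ω M F) (N : FractureNetwork Ω I) (W : D.Weights)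

open Classical in
theorem coupling_eq [Fintype F] (lam : D.MultiplierSpace N) (v : D.DofFamily N) :
    D.coupling N W lam v = ∑ σ : D.fractureFaces N, D.faceArea σ * ⟪lam σ, D.jump N W v σ⟫_ℝ := by
  refine Finset.sum_congr rfl fun σ _ => ?_
  rw [setIntegral_const, smul_eq_mul, faceArea]

/-- The coupling `∫_Γ λ · ⟦v⟧` as a bilinear map. -/
noncomputable def couplingMap [Fintype F] :
    D.MultiplierSpace N →ₗ[ℝ] D.displacementSpace N →ₗ[ℝ] ℝ :=
  LinearMap.mk₂ ℝ (fun lam v => D.coupling N W lam v)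
    (fun l l' v => by
      simp only [coupling_eq, Pi.add_apply, inner_add_left, mul_add, Finset.sum_add_distrib])
    (fun r l v => by
      simp only [coupling_eq, Pi.smul_apply, real_inner_smul_left, mul_left_comm _ r,
        ← Finset.mul_sum, smul_eq_mul])
    (fun l v v' => by
      simp only [coupling_eq, Submodule.coe_add, jump_add, inner_add_right, mul_add,
        Finset.sum_add_distrib])
    (fun r l v => by
      simp only [coupling_eq, Submodule.coe_smul, jump_smul, real_inner_smul_right,
        mul_left_comm _ r, ← Finset.mul_sum, smul_eq_mul])

open Classical in
/-- The displacement with zero nodal values, made of the bubbles `lam σ` only, whose jump is `lam`. -/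
noncomputable def bubble (lam : D.MultiplierSpace N) : D.displacementSpace N :=
  ⟨(0, fun K σ => if K = D.plusCell N σ then lam σ else 0), by
    refine ⟨fun _ _ _ => rfl, fun K σ h => ?_, fun _ _ _ => rfl, fun _ _ _ _ => rfl⟩
    refine if_neg fun hK => h ?_
    rw [hK]
    exact (D.exists_plus_minus N σ).1.choose_spec⟩

theorem jump_bubble (lam : D.MultiplierSpace N) (σ : D.fractureFaces N) :
    D.jump N W (D.bubble N lam) σ = lam σ := by
  simp [jump, bubble, faceMean]

/-- The bubbles provide the inf-sup condition. -/
theorem couplingMap_injective [Fintype F] : Function.Injective (D.couplingMap N W) := by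
  classical
  rw [injective_iff_map_eq_zero]
  intro lam h
  have h1 : D.coupling N W lam (D.bubble N lam) = 0 :=
    congrArg (fun l : D.displacementSpace N →ₗ[ℝ] ℝ => l (D.bubble N lam)) h
  rw [coupling_eq] at h1
  simp only [jump_bubble] at h1
  replace h1 := (Finset.sum_eq_zero_iff_of_nonneg fun (σ : D.fractureFaces N) _ =>
    mul_nonneg (D.faceArea_pos σ).le (real_inner_self_nonneg (x := lam σ))).1 h1
  funext σ
  have h2 := (mul_eq_zero.1 (h1 σ (Finset.mem_univ σ))).resolve_left (D.faceArea_pos σ).ne'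
  exact inner_self_eq_zero.1 h2

theorem load_eq [Fintype M] {f : Space d → Space d} (hf : MemLp f 2 (volume.restrict Ω.carrier))
    (v : D.DofFamily N) :
    D.load N W f v = ∑ K, ⟪D.cellMean N W v K, ∫ x in D.cell K, f x⟫_ℝ := by
  refine Finset.sum_congr rfl fun K _ => ?_
  have : IsFiniteMeasure (volume.restrict (D.cell K)) :=
    ⟨by rw [Measure.restrict_apply_univ]; exact D.measure_cell_lt_top K⟩
  have hint : Integrable f (volume.restrict (D.cell K)) :=
    (hf.mono_measure (Measure.restrict_mono (D.cell_subset_domain K) le_rfl)).integrable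
      one_le_two
  rw [← integral_inner hint]
  simp only [real_inner_comm]

/-- The load `∫_Ω f · Π̃ v` as a linear form. -/
noncomputable def loadMap [Fintype M] {f : Space d → Space d}
    (hf : MemLp f 2 (volume.restrict Ω.carrier)) : D.displacementSpace N →ₗ[ℝ] ℝ where
  toFun v := D.load N W f v
  map_add' v w := by
    simp only [load_eq D N W hf, Submodule.coe_add, cellMean_add, inner_add_left,
      Finset.sum_add_distrib]
  map_smul' r v := by
    simp only [load_eq D N W hf, Submodule.coe_smul, cellMean_smul, real_inner_smul_left,
      ← Finset.mul_sum, smul_eq_mul, RingHom.id_apply]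

theorem isClosed_dualCone (g : D.fractureFaces N → ℝ) : IsClosed (D.dualCone N g) := by
  simp only [dualCone, ofPred_forall, ofPred_and]
  refine isClosed_iInter fun σ => (isClosed_le ?_ ?_).inter (isClosed_le ?_ ?_) <;> fun_prop

theorem convex_dualCone (g : D.fractureFaces N → ℝ) : Convex ℝ (D.dualCone N g) := by
  intro l hl m hm a b ha hb hab σ
  obtain ⟨hl1, hl2⟩ := hl σ
  obtain ⟨hm1, hm2⟩ := hm σ
  simp only [Pi.add_apply, Pi.smul_apply, inner_add_left, real_inner_smul_left]
  refine ⟨by positivity, ?_⟩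
  set n := D.plusNormal N σ
  have h1 : a • l σ + b • m σ - (a * ⟪l σ, n⟫_ℝ + b * ⟪m σ, n⟫_ℝ) • n =
      a • (l σ - ⟪l σ, n⟫_ℝ • n) + b • (m σ - ⟪m σ, n⟫_ℝ • n) := by module
  rw [h1]
  calc _ ≤ a * ‖l σ - ⟪l σ, n⟫_ℝ • n‖ + b * ‖m σ - ⟪m σ, n⟫_ℝ • n‖ := by
        refine (norm_add_le _ _).trans (le_of_eq ?_)
        rw [norm_smul, norm_smul, Real.norm_of_nonneg ha, Real.norm_of_nonneg hb]
    _ ≤ a * g σ + b * g σ := by gcongr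
    _ = g σ := by rw [← add_mul, hab, one_mul]

end Coupling

end PolytopalMesh

theorem proposition4p1 {d : ℕ} (hd : 2 ≤ d) (Ω : PolyhedralDomain d)
    {I : Type*} [Finite I] (N : FractureNetwork Ω I)
    (hΓ : IsConnected (Ω.carrier \ N.closedNetwork))
    {M F : Type*} [Fintype M] [Fintype F] (D : PolytopalMesh Ω M F) (hD : D.IsConforming N)
    (W : D.Weights) (mu la : Space d → ℝ)
    (hmu : IntegrableOn mu Ω.carrier) (hla : IntegrableOn la Ω.carrier)
    (hmu_pos : ∀ᵐ x ∂volume.restrict Ω.carrier, 0 < mu x)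
    (hla_pos : ∀ᵐ x ∂volume.restrict Ω.carrier, 0 < 2 * mu x + d * la x)
    (g : D.fractureFaces N → ℝ) (hg : ∀ σ, 0 ≤ g σ)
    (f : Space d → Space d) (hf : MemLp f 2 (volume.restrict Ω.carrier)) :
    ∃! p : D.displacementSpace N × D.MultiplierSpace N,
      D.IsDiscreteSolution N W mu la g f p.1 p.2 := by
  -- the finite index type of the multipliers is a subtype of `F`, with no decidability at hand
  classical
  have hd1 : 1 ≤ d := by omega
  have henergy := D.energy_self_nonneg_and_definite N W hd1 hΓ hD hmu hla hmu_pos hla_pos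
  have hne : (D.dualCone N g).Nonempty := ⟨0, fun σ => by simpa using hg σ⟩
  obtain ⟨p, ⟨h1, h2, h3⟩, huniq⟩ := existsUnique_saddlePoint (D.energy N W hmu hla)
    (D.energy_comm N W hmu hla) (fun u => (henergy u).1) (fun u => (henergy u).2)
    (D.couplingMap N W) (D.couplingMap_injective N W) (D.loadMap N W hf) hne
    (D.isClosed_dualCone N g) (D.convex_dualCone N g)
  exact ⟨p, ⟨h1, h2, h3⟩, fun q hq => huniq q ⟨hq.mem_cone, hq.equilibrium, hq.inequality⟩⟩
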